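/- Call a Hausdorff topological space $X$ uniquely arcwise connected if every two distinct points $x,y\in X$ are joined by exactly one arc, that is, there is exactly one subset $A\subseteq X$ for which there exists a homeomorphism $[0,1]\to A$ with $0\mapsto x$ and $1\mapsto y$ (for example, $X$ may be a tree or a dendrite). Let $X$ be a non-empty uniquely arcwise connected space and let $n\geq 3$ be an integer. Then every action of $\mathrm{Aut}(F_n)$ on $X$ by homeomorphisms has a global fixed point, where $F_n$ is the free group of rank $n$, and every action of $\mathrm{SL}_n(\mathbb{Z})$ on $X$ by homeomorphisms has a global fixed point. In other words, if $\Gamma=\mathrm{Aut}(F_n)$ or $\Gamma=\mathrm{SL}_n(\mathbb{Z})$, then for every group homomorphism $\rho:\Gamma\to\mathrm{Homeo}(X)$ there is $x\in X$ with $\rho(g)(x)=x$ for all $g\in\Gamma$. -/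

import Mathlib

/-- `A` is an arc in `X` with endpoints `x` and `y`: a subset (with the subspace topology)
homeomorphic to the closed interval `[0, 1]`, the endpoints corresponding to `x` and `y`. -/
def IsArcJoining {X : Type*} [TopologicalSpace X] (x y : X) (A : Set X) : Prop :=
  ∃ e : unitInterval ≃ₜ A, (e 0 : X) = x ∧ (e 1 : X) = y

/-- A uniquely arcwise connected space: a Hausdorff space in which every two distinct points are
joined by exactly one arc (as a subset of the space). -/
structure UniquelyArcwiseConnected (X : Type*) [TopologicalSpace X] : Prop where
  hausdorff : T2Space X
  existsUnique_arc : ∀ x y : X, x ≠ y → ∃! A : Set X, IsArcJoining x y A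

/-! ### Arcs, medians and fixed points in uniquely arcwise connected spaces -/

namespace UniquelyArcwiseConnected

open Set

variable {X : Type*} [TopologicalSpace X]

/-! A uniquely arcwise connected space behaves like a tree. Any three points have a unique median,
so three convex sets that meet pairwise have a common point, and by induction so does any finite
family of pairwise intersecting convex sets (`helly`). The fixed set of a homeomorphism of finite
order is convex, because an increasing self-map of an interval of finite order is the identity
(`arcConvex_fixed`). Two involutions `s`, `t` with `(s * t) ^ 24 = 1` have a common fixed point
(`exists_common_fixed`): since 24 is a product of twos and threes, `s * t` has a fixed point by
intermediate value and median arguments; it then fixes an arc that `s` flips, and the point of that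
arc fixed by `s` is fixed by `t` too. Hence a group generated by finitely many involutions whose
pairwise products have order dividing 24 fixes a point in every action (`exists_global_fixed`).

What remains is algebra: such generators are needed for both groups. Three distinct indices `a`,
`b`, `c` support four of them, and every further index `k` contributes one more. A transvection is
hidden in the generator called fold, as a product with an element of order two. The pairwise orders
are checked on generators or basis vectors. Generation reduces to the classical facts that
`Aut(F_n)` is generated by signed permutations and transvections (Nielsen, `eq_top_of_nielsen`) and
`SL_n(ℤ)` by transvections (`eq_top_of_transvection_mem`).

Nielsen's theorem is proved by minimising, over a coset of the subgroup, the total complexity of the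
images of the generators. A minimal tuple is Nielsen reduced, so a product along a reduced word is
at least as long as that word; since the tuple is a basis, the inverse automorphism sends generators
to letters. -/

/-- The arc from `x` to `y`, understood as `{x}` if `x = y`. -/
def seg (x y : X) : Set X := {z | (x = y ∧ z = x) ∨ ∃ A, IsArcJoining x y A ∧ z ∈ A}

theorem ne_of_isArcJoining {x y : X} {A : Set X} (h : IsArcJoining x y A) : x ≠ y := by
  obtain ⟨e, rfl, rfl⟩ := h
  intro h
  exact zero_ne_one (e.injective (Subtype.ext h))

theorem seg_self (x : X) : seg x x = {x} := by
  ext z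
  simp only [seg, mem_ofPred_eq, true_and, mem_singleton_iff]
  refine ⟨?_, Or.inl⟩
  rintro (h | ⟨A, hA, -⟩)
  · exact h
  · exact (ne_of_isArcJoining hA rfl).elim

theorem seg_eq_of_isArcJoining (hX : UniquelyArcwiseConnected X) {x y : X} {A : Set X}
    (h : IsArcJoining x y A) : seg x y = A := by
  have hxy := ne_of_isArcJoining h
  ext z
  simp only [seg, mem_ofPred_eq, hxy, false_and, false_or]
  refine ⟨?_, fun hz => ⟨A, h, hz⟩⟩
  rintro ⟨B, hB, hz⟩
  rwa [(hX.existsUnique_arc x y hxy).unique h hB]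

theorem isArcJoining_seg (hX : UniquelyArcwiseConnected X) {x y : X} (h : x ≠ y) :
    IsArcJoining x y (seg x y) := by
  obtain ⟨A, hA, -⟩ := hX.existsUnique_arc x y h
  rwa [seg_eq_of_isArcJoining hX hA]

/-- A continuous injection of a compact interval into a Hausdorff space is an embedding, so its
image is an arc, and arcs are unique. This lets statements about segments be read off in a real
parameter; `a = b` is allowed, so constant segments need no separate treatment. -/
theorem seg_eq_image (hX : UniquelyArcwiseConnected X) {γ : ℝ → X} {a b : ℝ} (hab : a ≤ b)
    (hc : ContinuousOn γ (Icc a b)) (hi : InjOn γ (Icc a b)) :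
    seg (γ a) (γ b) = γ '' Icc a b := by
  have := hX.hausdorff
  rcases hab.eq_or_lt with rfl | hab
  · simp [seg_self]
  · let σ : unitInterval → X := fun u => γ ((iccHomeoI a b hab).symm u)
    have hσc : Continuous σ :=
      hc.comp_continuous (by fun_prop) fun u => ((iccHomeoI a b hab).symm u).2
    have hσi : Function.Injective σ := fun u v huv =>
      (iccHomeoI a b hab).symm.injective
        (Subtype.ext (hi ((iccHomeoI a b hab).symm u).2 ((iccHomeoI a b hab).symm v).2 huv))
    have hr : range σ = γ '' Icc a b := by
      have : σ = (fun u : Icc a b => γ u) ∘ (iccHomeoI a b hab).symm := rfl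
      rw [this, (iccHomeoI a b hab).symm.surjective.range_comp, image_eq_range]
    rw [← hr]
    apply seg_eq_of_isArcJoining hX
    refine ⟨(hσc.isClosedEmbedding hσi).isEmbedding.toHomeomorph, ?_, ?_⟩
    · change γ ((iccHomeoI a b hab).symm 0) = γ a
      simp
    · change γ ((iccHomeoI a b hab).symm 1) = γ b
      simp

theorem exists_param (hX : UniquelyArcwiseConnected X) (x y : X) :
    ∃ (γ : ℝ → X) (b : ℝ), 0 ≤ b ∧ ContinuousOn γ (Icc 0 b) ∧ InjOn γ (Icc 0 b) ∧
      γ 0 = x ∧ γ b = y := by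
  by_cases h : x = y
  · exact ⟨fun _ => x, 0, le_rfl, continuousOn_const, by simp, rfl, h⟩
  · obtain ⟨e, h0, h1⟩ := isArcJoining_seg hX h
    refine ⟨fun t => e (projIcc 0 1 zero_le_one t), 1, zero_le_one, ?_, ?_, ?_, ?_⟩
    · have : Continuous fun t : ℝ => ((e (projIcc 0 1 zero_le_one t) : seg x y) : X) :=
        continuous_subtype_val.comp (e.continuous.comp continuous_projIcc)
      exact this.continuousOn
    · intro s hs t ht hst
      have := e.injective (Subtype.ext hst)
      rw [projIcc_of_mem _ hs, projIcc_of_mem _ ht] at this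
      exact congrArg Subtype.val this
    · simpa using h0
    · simpa using h1

/-- A parametrisation of `seg x y` together with the description of all its subsegments. -/
theorem exists_param_seg (hX : UniquelyArcwiseConnected X) (x y : X) :
    ∃ (γ : ℝ → X) (b : ℝ), 0 ≤ b ∧ ContinuousOn γ (Icc 0 b) ∧ InjOn γ (Icc 0 b) ∧
      γ 0 = x ∧ γ b = y ∧ seg x y = γ '' Icc 0 b ∧
      ∀ s t, 0 ≤ s → s ≤ t → t ≤ b → seg (γ s) (γ t) = γ '' Icc s t := by
  obtain ⟨γ, b, hb, hc, hi, h0, h1⟩ := exists_param hX x y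
  refine ⟨γ, b, hb, hc, hi, h0, h1, ?_, fun s t hs hst ht => ?_⟩
  · rw [← h0, ← h1, seg_eq_image hX hb hc hi]
  · have hsub : Icc s t ⊆ Icc 0 b := Icc_subset_Icc hs ht
    exact seg_eq_image hX hst (hc.mono hsub) (hi.mono hsub)

theorem seg_comm (hX : UniquelyArcwiseConnected X) (x y : X) : seg x y = seg y x := by
  obtain ⟨γ, b, hb, hc, hi, rfl, rfl, h, -⟩ := exists_param_seg hX x y
  have hm : MapsTo (fun t : ℝ => b - t) (Icc 0 b) (Icc 0 b) := fun t ht => by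
    simp only [mem_Icc] at ht ⊢
    constructor <;> linarith [ht.1, ht.2]
  have h2 := seg_eq_image hX (γ := fun t => γ (b - t)) hb (hc.comp (by fun_prop) hm)
    (hi.comp (fun s _ t _ hst => by simpa using hst) hm)
  simp only [sub_zero, sub_self] at h2
  rw [h, h2]
  ext z
  constructor
  · rintro ⟨t, ht, rfl⟩
    exact ⟨b - t, hm ht, by simp⟩
  · rintro ⟨t, ht, rfl⟩
    exact ⟨b - t, hm ht, rfl⟩

theorem left_mem_seg (hX : UniquelyArcwiseConnected X) (x y : X) : x ∈ seg x y := by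
  obtain ⟨γ, b, hb, -, -, rfl, -, h, -⟩ := exists_param_seg hX x y
  rw [h]
  exact ⟨0, ⟨le_rfl, hb⟩, rfl⟩

theorem right_mem_seg (hX : UniquelyArcwiseConnected X) (x y : X) : y ∈ seg x y := by
  rw [seg_comm hX]
  exact left_mem_seg hX y x

theorem isCompact_seg (hX : UniquelyArcwiseConnected X) (x y : X) : IsCompact (seg x y) := by
  obtain ⟨γ, b, -, hc, -, -, -, h, -⟩ := exists_param_seg hX x y
  rw [h]
  exact isCompact_Icc.image_of_continuousOn hc

theorem seg_subset_left (hX : UniquelyArcwiseConnected X) {x y z : X} (hz : z ∈ seg x y) :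
    seg x z ⊆ seg x y := by
  obtain ⟨γ, b, hb, hc, hi, rfl, rfl, h, hs⟩ := exists_param_seg hX x y
  rw [h] at hz
  obtain ⟨t, ht, rfl⟩ := hz
  rw [h, hs 0 t le_rfl ht.1 ht.2]
  exact image_mono (Icc_subset_Icc_right ht.2)

theorem seg_inter (hX : UniquelyArcwiseConnected X) {x y z w : X} (hz : z ∈ seg x y)
    (h1 : w ∈ seg x z) (h2 : w ∈ seg z y) : w = z := by
  obtain ⟨γ, b, hb, hc, hi, rfl, rfl, h, hs⟩ := exists_param_seg hX x y
  rw [h] at hz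
  obtain ⟨t, ht, rfl⟩ := hz
  rw [hs 0 t le_rfl ht.1 ht.2] at h1
  rw [hs t b ht.1 ht.2 le_rfl] at h2
  obtain ⟨u, hu, rfl⟩ := h1
  obtain ⟨v, hv, hvu⟩ := h2
  have : v = u := hi ⟨ht.1.trans hv.1, hv.2⟩ ⟨hu.1, hu.2.trans ht.2⟩ hvu
  have : u = t := le_antisymm hu.2 (this ▸ hv.1)
  rw [this]

theorem seg_total (hX : UniquelyArcwiseConnected X) {x y z w : X} (hz : z ∈ seg x y)
    (hw : w ∈ seg x y) : (z ∈ seg x w ∧ w ∈ seg z y) ∨ (w ∈ seg x z ∧ z ∈ seg w y) := by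
  obtain ⟨γ, b, hb, hc, hi, rfl, rfl, h, hs⟩ := exists_param_seg hX x y
  rw [h] at hz hw
  obtain ⟨s, hs', rfl⟩ := hz
  obtain ⟨t, ht', rfl⟩ := hw
  rw [hs 0 s le_rfl hs'.1 hs'.2, hs 0 t le_rfl ht'.1 ht'.2, hs s b hs'.1 hs'.2 le_rfl,
    hs t b ht'.1 ht'.2 le_rfl]
  rcases le_total s t with hst | hst
  · exact Or.inl ⟨⟨s, ⟨hs'.1, hst⟩, rfl⟩, ⟨t, ⟨hst, ht'.2⟩, rfl⟩⟩
  · exact Or.inr ⟨⟨t, ⟨ht'.1, hst⟩, rfl⟩, ⟨s, ⟨hst, hs'.2⟩, rfl⟩⟩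

/-- Two arcs that share only the endpoint `m` concatenate to an injective path, which must be the
segment. -/
theorem mem_seg_of_inter (hX : UniquelyArcwiseConnected X) {x y m : X}
    (h : ∀ w, w ∈ seg x m → w ∈ seg m y → w = m) : m ∈ seg x y := by
  obtain ⟨γ, b, hb, hc, hi, rfl, hγ, hseg, -⟩ := exists_param_seg hX x m
  obtain ⟨δ, c, hc0, hd, hj, hδ, rfl, hseg', -⟩ := exists_param_seg hX m y
  have hd' : ContinuousOn (fun t => δ (t - b)) (Icc b (b + c)) :=
    hd.comp (by fun_prop) fun t ht => ⟨by linarith [ht.1], by linarith [ht.2]⟩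
  let η : ℝ → X := fun t => if t ≤ b then γ t else δ (t - b)
  have e1 : EqOn η γ (Icc 0 b) := fun t ht => by simp [η, ht.2]
  have e2 : EqOn η (fun t => δ (t - b)) (Icc b (b + c)) := fun t ht => by
    rcases ht.1.eq_or_lt with h' | h'
    · subst h'
      simp [η, hγ, hδ]
    · simp [η, h']
  have hcover : Icc 0 b ∪ Icc b (b + c) = Icc 0 (b + c) := Icc_union_Icc_eq_Icc hb (by linarith)
  have hcont : ContinuousOn η (Icc 0 (b + c)) := by
    rw [← hcover]
    exact (hc.congr e1).union_of_isClosed (hd'.congr e2) isClosed_Icc isClosed_Icc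
  have key : ∀ s t, s ∈ Icc 0 b → t ∈ Icc b (b + c) → η s = η t → s = t := by
    intro s t hs ht hst
    rw [e1 hs, e2 ht] at hst
    have ht' : t - b ∈ Icc 0 c := ⟨by linarith [ht.1], by linarith [ht.2]⟩
    have h3 := h (γ s) (hseg ▸ mem_image_of_mem γ hs)
      (hseg' ▸ ⟨t - b, ht', hst.symm⟩)
    have h4 : s = b := hi hs ⟨hb, le_rfl⟩ (h3.trans hγ.symm)
    have h5 : t - b = 0 := hj ht' ⟨le_rfl, hc0⟩ ((hst.symm.trans h3).trans hδ.symm)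
    linarith
  have hinj : InjOn η (Icc 0 (b + c)) := by
    intro s hs t ht hst
    rw [← hcover] at hs ht
    rcases hs with hs | hs <;> rcases ht with ht | ht
    · rw [e1 hs, e1 ht] at hst
      exact hi hs ht hst
    · exact key s t hs ht hst
    · exact (key t s ht hs hst.symm).symm
    · rw [e2 hs, e2 ht] at hst
      have := hj ⟨by linarith [hs.1], by linarith [hs.2]⟩
        ⟨by linarith [ht.1], by linarith [ht.2]⟩ hst
      linarith
  have := seg_eq_image hX (by linarith) hcont hinj
  have h0 : η 0 = γ 0 := e1 ⟨le_rfl, hb⟩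
  have h1 : η (b + c) = δ c := by
    rw [e2 ⟨by linarith, le_rfl⟩]
    simp
  rw [h0, h1] at this
  rw [this]
  exact ⟨b, ⟨hb, by linarith⟩, by rw [e1 ⟨hb, le_rfl⟩, hγ]⟩

/-- The median is the first point at which the arc from `z` to `x` hits the arc from `x` to `y`.
Being first, it is the only common point of the arcs that join it to `z` and to `y`, so these
concatenate. -/
theorem exists_median (hX : UniquelyArcwiseConnected X) (x y z : X) :
    ∃ m, m ∈ seg x y ∧ m ∈ seg z x ∧ m ∈ seg z y := by
  have := hX.hausdorff
  obtain ⟨γ, b, hb, hc, hi, rfl, rfl, h, hs⟩ := exists_param_seg hX z x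
  have hclosed : IsClosed (seg (γ b) y) := (isCompact_seg hX _ _).isClosed
  have hK : IsCompact (Icc 0 b ∩ γ ⁻¹' seg (γ b) y) :=
    isCompact_Icc.of_isClosed_subset (hc.preimage_isClosed_of_isClosed isClosed_Icc hclosed)
      inter_subset_left
  obtain ⟨t, ⟨ht, htm⟩, hmin⟩ := hK.exists_isLeast ⟨b, ⟨hb, le_rfl⟩, left_mem_seg hX _ _⟩
  have first : ∀ w, w ∈ seg (γ 0) (γ t) → w ∈ seg (γ b) y → w = γ t := by
    intro w hw hwK
    rw [hs 0 t le_rfl ht.1 ht.2] at hw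
    obtain ⟨u, hu, rfl⟩ := hw
    have : t ≤ u := hmin ⟨⟨hu.1, hu.2.trans ht.2⟩, hwK⟩
    rw [le_antisymm hu.2 this]
  refine ⟨γ t, htm, h ▸ mem_image_of_mem γ ht, mem_seg_of_inter hX fun w h1 h2 => first w h1 ?_⟩
  rw [seg_comm hX] at htm ⊢
  rw [seg_comm hX] at h2
  exact seg_subset_left hX htm h2

theorem mem_seg_trans (hX : UniquelyArcwiseConnected X) {x z m m' : X}
    (h1 : m ∈ seg x m') (h2 : m' ∈ seg x z) : m' ∈ seg m z := by
  rcases seg_total hX (seg_subset_left hX h2 h1) h2 with h | h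
  · exact h.2
  · have := seg_inter hX h1 h.1 (right_mem_seg hX m m')
    rw [this]
    exact left_mem_seg hX _ _

/-- Two medians are ordered along the arc from `x` to `y`. If `m` comes first, `m'` lies both
between `m` and `z` and between `m` and `y`; but `m` separates these two halves of the arc from `z`
to `y`. -/
theorem median_unique (hX : UniquelyArcwiseConnected X) {x y z m m' : X}
    (h1 : m ∈ seg x y) (h2 : m ∈ seg z x) (h3 : m ∈ seg z y)
    (h1' : m' ∈ seg x y) (h2' : m' ∈ seg z x) (h3' : m' ∈ seg z y) : m = m' := by
  have aux : ∀ {x y m m' : X}, m ∈ seg z x → m ∈ seg z y → m' ∈ seg z x → m' ∈ seg z y →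
      m ∈ seg x m' → m' ∈ seg m y → m = m' := by
    intro x y m m' h2 h3 h2' h3' ha hb
    rw [seg_comm hX] at h2'
    have h4 : m' ∈ seg m z := mem_seg_trans hX ha h2'
    rw [seg_comm hX] at h4
    exact (seg_inter hX h3 h4 hb).symm
  rcases seg_total hX h1 h1' with h | h
  · exact aux h2 h3 h2' h3' h.1 h.2
  · exact (aux h2' h3' h2 h3 h.1 h.2).symm

theorem image_seg (hX : UniquelyArcwiseConnected X) (g : X ≃ₜ X) (x y : X) :
    g '' seg x y = seg (g x) (g y) := by
  obtain ⟨γ, b, hb, hc, hi, rfl, rfl, h, -⟩ := exists_param_seg hX x y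
  have := seg_eq_image hX (γ := g ∘ γ) hb (g.continuous.comp_continuousOn hc)
    (g.injective.injOn.comp hi (mapsTo_univ _ _))
  simp only [Function.comp_apply] at this
  rw [this, h, image_image]

theorem map_mem_seg (hX : UniquelyArcwiseConnected X) (g : X ≃ₜ X) {x y z : X}
    (h : z ∈ seg x y) : g z ∈ seg (g x) (g y) :=
  image_seg hX g x y ▸ mem_image_of_mem g h

/-- A set is convex if it contains the arcs between its points. -/
def ArcConvex (C : Set X) : Prop := ∀ x ∈ C, ∀ y ∈ C, seg x y ⊆ C

theorem ArcConvex.inter {C D : Set X} (hC : ArcConvex C) (hD : ArcConvex D) :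
    ArcConvex (C ∩ D) := fun x hx y hy =>
  subset_inter (hC x hx.1 y hy.1) (hD x hx.2 y hy.2)

/-- The median of three points chosen in the pairwise intersections lies in all three sets. The
shape of the conclusion is the pairwise hypothesis for the sets `C i ∩ C a` in the induction of
`helly`. -/
theorem helly_three (hX : UniquelyArcwiseConnected X) {A B C : Set X} (hA : ArcConvex A)
    (hB : ArcConvex B) (hC : ArcConvex C) (hAB : (A ∩ B).Nonempty) (hAC : (A ∩ C).Nonempty)
    (hBC : (B ∩ C).Nonempty) : ((A ∩ C) ∩ (B ∩ C)).Nonempty := by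
  obtain ⟨x, hxA, hxB⟩ := hAB
  obtain ⟨y, hyA, hyC⟩ := hAC
  obtain ⟨z, hzB, hzC⟩ := hBC
  obtain ⟨m, h1, h2, h3⟩ := exists_median hX x y z
  exact ⟨m, ⟨hA x hxA y hyA h1, hC z hzC y hyC h3⟩, hB z hzB x hxB h2, hC z hzC y hyC h3⟩

theorem helly (hX : UniquelyArcwiseConnected X) [Nonempty X] {ι : Type*} (s : Finset ι) :
    ∀ C : ι → Set X, (∀ i ∈ s, ArcConvex (C i)) →
      (∀ i ∈ s, ∀ j ∈ s, (C i ∩ C j).Nonempty) → ∃ x, ∀ i ∈ s, x ∈ C i := by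
  classical
  induction s using Finset.induction_on with
  | empty => exact fun C _ _ => ⟨Classical.arbitrary X, by simp⟩
  | insert a s _ ih =>
    intro C hC hne
    rcases s.eq_empty_or_nonempty with rfl | ⟨i₀, hi₀⟩
    · obtain ⟨x, hx, -⟩ := hne a (by simp) a (by simp)
      exact ⟨x, by simpa using hx⟩
    · have ha : a ∈ insert a s := Finset.mem_insert_self a s
      have hs : ∀ i ∈ s, i ∈ insert a s := fun i hi => Finset.mem_insert_of_mem hi
      obtain ⟨x, hx⟩ := ih (fun i => C i ∩ C a)
        (fun i hi => (hC i (hs i hi)).inter (hC a ha))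
        (fun i hi j hj => helly_three hX (hC i (hs i hi)) (hC j (hs j hj)) (hC a ha)
          (hne i (hs i hi) j (hs j hj)) (hne i (hs i hi) a ha) (hne j (hs j hj) a ha))
      refine ⟨x, fun i hi => ?_⟩
      rcases Finset.mem_insert.1 hi with rfl | hi
      · exact (hx i₀ hi₀).2
      · exact (hx i hi).1

/-- The arc between the exchanged points is mapped to itself, and a continuous self-map of `[0, 1]`
has a fixed point. -/
theorem exists_fixed_of_swap (hX : UniquelyArcwiseConnected X) (g : X ≃ₜ X) {x y : X}
    (hx : g x = y) (hy : g y = x) : ∃ z ∈ seg x y, g z = z := by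
  by_cases hxy : x = y
  · exact ⟨x, left_mem_seg hX x y, hx.trans hxy.symm⟩
  · obtain ⟨e, h0, h1⟩ := isArcJoining_seg hX hxy
    have hmaps : ∀ u, g (e u) ∈ seg x y := fun u => by
      have := map_mem_seg hX g (e u).2
      rwa [hx, hy, seg_comm hX] at this
    let f : unitInterval → unitInterval := fun u => e.symm ⟨g (e u), hmaps u⟩
    have hf : Continuous f := e.symm.continuous.comp
      ((g.continuous.comp (continuous_subtype_val.comp e.continuous)).subtype_mk _)
    obtain ⟨u, hu⟩ := intermediate_value_univ₂ (a := 0) (b := 1) continuous_id hf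
      unitInterval.nonneg' unitInterval.le_one'
    refine ⟨e u, (e u).2, ?_⟩
    have := congrArg e hu
    simp only [id, f, e.apply_symm_apply] at this
    exact (congrArg Subtype.val this).symm

/-- On an arc with fixed endpoints the homeomorphism becomes an increasing self-map of `[0, 1]`. The
orbit of a point that moves is strictly monotone, which finite order forbids. -/
theorem arcConvex_fixed (hX : UniquelyArcwiseConnected X) (g : X ≃ₜ X) {k : ℕ} (hk : 0 < k)
    (hg : g ^ k = 1) : ArcConvex {x | g x = x} := by
  intro x hx y hy z hz
  by_cases hxy : x = y
  · subst hxy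
    rw [seg_self] at hz
    rw [hz]
    exact hx
  · obtain ⟨e, h0, h1⟩ := isArcJoining_seg hX hxy
    have hmaps : ∀ u, g (e u) ∈ seg x y := fun u => by
      have := map_mem_seg hX g (e u).2
      rwa [hx, hy] at this
    let f : unitInterval → unitInterval := fun u => e.symm ⟨g (e u), hmaps u⟩
    have hef : ∀ u, (e (f u) : X) = g (e u) := fun u => by simp [f]
    have hf : Continuous f := e.symm.continuous.comp
      ((g.continuous.comp (continuous_subtype_val.comp e.continuous)).subtype_mk _)
    have hinj : Function.Injective f := fun u v huv => by
      have := congrArg (fun w => (e w : X)) huv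
      simp only [hef] at this
      exact e.injective (Subtype.ext (g.injective this))
    have hiter : ∀ j u, (e (f^[j] u) : X) = (g ^ j) (e u) := by
      intro j
      induction j with
      | zero => intro u; rfl
      | succ j ih => intro u; rw [Function.iterate_succ_apply, ih, hef, pow_succ]; rfl
    have hfk : ∀ u, f^[k] u = u := fun u => e.injective (Subtype.ext (by rw [hiter, hg]; rfl))
    have hf0 : f 0 = 0 := e.injective (Subtype.ext (by rw [hef, h0]; exact hx))
    have hf1 : f 1 = 1 := e.injective (Subtype.ext (by rw [hef, h1]; exact hy))
    have hmono : StrictMono f := by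
      rcases hf.strictMono_of_inj hinj with h | h
      · exact h
      · have := h (zero_lt_one (α := unitInterval))
        rw [hf0, hf1] at this
        exact absurd this (not_lt.2 zero_le_one)
    have hid : ∀ u, f u = u := by
      intro u
      rcases lt_trichotomy (f u) u with h | h | h
      · have := (hmono.strictAnti_iterate_of_map_lt h) hk
        simp [hfk] at this
      · exact h
      · have := (hmono.strictMono_iterate_of_lt_map h) hk
        simp [hfk] at this
    have := hef (e.symm ⟨z, hz⟩)
    rw [hid] at this
    simpa using this.symm

theorem exists_fixed_of_sq (hX : UniquelyArcwiseConnected X) (g : X ≃ₜ X)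
    (h : ∃ x, (g ^ 2) x = x) : ∃ x, g x = x := by
  obtain ⟨x, hx⟩ := h
  obtain ⟨z, -, hz⟩ := exists_fixed_of_swap hX g (x := x) rfl hx
  exact ⟨z, hz⟩

/-- `g` permutes `x`, `g x`, `g (g x)` cyclically, hence fixes their unique median. -/
theorem exists_fixed_of_cube (hX : UniquelyArcwiseConnected X) (g : X ≃ₜ X)
    (h : ∃ x, (g ^ 3) x = x) : ∃ x, g x = x := by
  obtain ⟨x, hx⟩ := h
  replace hx : g (g (g x)) = x := hx
  obtain ⟨m, h1, h2, h3⟩ := exists_median hX x (g x) (g (g x))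
  refine ⟨m, ?_⟩
  have h1' := map_mem_seg hX g h1
  have h2' := map_mem_seg hX g h2
  have h3' := map_mem_seg hX g h3
  rw [hx] at h2' h3'
  rw [seg_comm hX] at h1' h3'
  exact median_unique hX h2' h3' h1' h1 h2 h3

/-- Write `24 = 3 * 2 * 2 * 2` and descend from a fixed point of `g ^ 24`, one prime factor at a
time. -/
theorem exists_fixed_of_pow_twentyFour (hX : UniquelyArcwiseConnected X) [Nonempty X] (g : X ≃ₜ X)
    (h : g ^ 24 = 1) : ∃ x, g x = x := by
  apply exists_fixed_of_cube hX
  apply exists_fixed_of_sq hX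
  apply exists_fixed_of_sq hX
  apply exists_fixed_of_sq hX
  simp only [← pow_mul]
  rw [h]
  exact ⟨Classical.arbitrary X, rfl⟩

/-- If `s * t` fixes `x`, it also fixes `s x = t x`, hence every point of the arc between them. The
involution `s` exchanges the ends of this arc and so fixes some `z` on it; then `t z = s z = z`. -/
theorem exists_common_fixed (hX : UniquelyArcwiseConnected X) [Nonempty X] (s t : X ≃ₜ X)
    (hs : s ^ 2 = 1) (ht : t ^ 2 = 1) (hst : (s * t) ^ 24 = 1) : ∃ x, s x = x ∧ t x = x := by
  have hss : ∀ x, s (s x) = x := fun x => DFunLike.congr_fun hs x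
  have htt : ∀ x, t (t x) = x := fun x => DFunLike.congr_fun ht x
  obtain ⟨x, hx⟩ := exists_fixed_of_pow_twentyFour hX (s * t) hst
  replace hx : s (t x) = x := hx
  have hx' : t x = s x := by rw [← hss (t x), hx]
  obtain ⟨z, hz, hsz⟩ := exists_fixed_of_swap hX s (x := x) rfl (hss x)
  have hgz : s (t z) = z := arcConvex_fixed hX (s * t) (by norm_num) hst x hx (s x)
    (show s (t (s x)) = s x by rw [← hx', htt, hx']) hz
  exact ⟨z, hsz, by rw [← hss (t z), hgz, hsz]⟩

/-- A group generated by finitely many involutions, any two of which generate a finite dihedral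
group of order dividing `48`, has a global fixed point whenever it acts on `X`. -/
theorem exists_global_fixed (hX : UniquelyArcwiseConnected X) [Nonempty X] {Γ : Type*} [Group Γ]
    {S : Set Γ} (hfin : S.Finite) (hgen : Subgroup.closure S = ⊤) (hsq : ∀ s ∈ S, s ^ 2 = 1)
    (hord : ∀ s ∈ S, ∀ t ∈ S, (s * t) ^ 24 = 1) (ρ : Γ →* (X ≃ₜ X)) : ∃ x : X, ∀ g, ρ g x = x := by
  obtain ⟨x, hx⟩ := helly hX hfin.toFinset (fun s => {x | ρ s x = x})
    (fun s hs => arcConvex_fixed hX (ρ s) two_pos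
      (by rw [← map_pow, hsq s (by simpa using hs), map_one]))
    (fun s hs t ht => exists_common_fixed hX (ρ s) (ρ t)
      (by rw [← map_pow, hsq s (by simpa using hs), map_one])
      (by rw [← map_pow, hsq t (by simpa using ht), map_one])
      (by rw [← map_mul, ← map_pow, hord s (by simpa using hs) t (by simpa using ht), map_one]))
  refine ⟨x, fun g => ?_⟩
  have hg : g ∈ Subgroup.closure S := hgen ▸ Subgroup.mem_top g
  induction hg using Subgroup.closure_induction with
  | mem s hs => exact hx s (by simpa using hs)
  | one => rw [map_one]; rfl
  | mul a b _ _ ha hb =>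
    rw [map_mul]
    show ρ a (ρ b x) = x
    rw [hb, ha]
  | inv a _ ha =>
    rw [map_inv]
    show (ρ a).symm x = x
    rw [Homeomorph.symm_apply_eq, ha]

end UniquelyArcwiseConnected

/-! ### Cancellation in free groups and a weight on words -/

namespace FreeGroup

variable {α : Type*}

/-- Compare the last letter of `L₁` with the first of `L₂`: either they do not cancel and the
concatenation is reduced, or both are stripped and the induction continues. -/
theorem IsReduced.exists_cancellation {L₁ : List (α × Bool)} :
    ∀ {L₂ : List (α × Bool)}, IsReduced L₁ → IsReduced L₂ →
      ∃ a c b, L₁ = a ++ c ∧ L₂ = invRev c ++ b ∧ IsReduced (a ++ b) := by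
  induction L₁ using List.reverseRecOn with
  | nil => exact fun {L₂} _ h₂ => ⟨[], [], L₂, rfl, rfl, h₂⟩
  | append_singleton l z ih =>
    intro L₂ h₁ h₂
    cases L₂ with
    | nil => exact ⟨l ++ [z], [], [], by simp, rfl, by simpa using h₁⟩
    | cons y L₂ =>
      by_cases hzy : z.1 = y.1 → z.2 = y.2
      · refine ⟨l ++ [z], [], y :: L₂, by simp, rfl, ?_⟩
        refine List.IsChain.append h₁ h₂ ?_
        intro x hx x' hx'
        simp only [List.getLast?_append, List.getLast?_singleton, Option.some_or,
          Option.mem_def, Option.some.injEq, List.head?_cons] at hx hx'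
        subst hx hx'
        exact hzy
      · obtain ⟨a, c, b, rfl, rfl, hab⟩ := ih (L₂ := L₂) (List.IsChain.left_of_append h₁)
          (List.IsChain.tail h₂)
        refine ⟨a, c ++ [z], b, by simp, ?_, hab⟩
        push Not at hzy
        obtain ⟨z1, z2⟩ := z
        obtain ⟨y1, y2⟩ := y
        obtain ⟨rfl, h⟩ := hzy
        have : y2 = !z2 := by cases y2 <;> cases z2 <;> simp_all
        subst this
        simp [invRev]

section Weight

variable [Fintype α]

/-- The numerical value of a word, read as a numeral. -/
noncomputable def numeral (L : List (α × Bool)) : ℕ :=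
  Nat.ofDigits (Fintype.card (α × Bool) + 2) (L.map fun a => (Fintype.equivFin (α × Bool) a : ℕ))

theorem numeral_append (L₁ L₂ : List (α × Bool)) : numeral (L₁ ++ L₂) =
    numeral L₁ + (Fintype.card (α × Bool) + 2) ^ L₁.length * numeral L₂ := by
  simp [numeral, Nat.ofDigits_append]

theorem numeral_lt (L : List (α × Bool)) :
    numeral L < (Fintype.card (α × Bool) + 2) ^ L.length := by
  have := Nat.ofDigits_lt_base_pow_length' (b := Fintype.card (α × Bool))
    (l := L.map fun a => (Fintype.equivFin (α × Bool) a : ℕ)) (fun x hx => by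
      obtain ⟨a, -, rfl⟩ := List.mem_map.1 hx
      have := (Fintype.equivFin (α × Bool) a).2
      omega)
  simpa [numeral] using this

theorem numeral_inj {L₁ L₂ : List (α × Bool)} (hlen : L₁.length = L₂.length)
    (h : numeral L₁ = numeral L₂) : L₁ = L₂ := by
  have hlt : ∀ L : List (α × Bool), ∀ x ∈ L.map fun a => (Fintype.equivFin (α × Bool) a : ℕ),
      x < Fintype.card (α × Bool) + 2 := fun L x hx => by
    obtain ⟨a, -, rfl⟩ := List.mem_map.1 hx
    have := (Fintype.equivFin (α × Bool) a).2
    omega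
  have := Nat.ofDigits_inj_of_len_eq (by omega) (by simpa using hlen) (hlt L₁) (hlt L₂) h
  exact List.map_injective_iff.2
    (Fin.val_injective.comp (Fintype.equivFin (α × Bool)).injective) this

/-- A weight on words that is invariant under inversion. -/
noncomputable def symNumeral (L : List (α × Bool)) : ℕ := numeral L + numeral (invRev L)

/-- The first letter is the least significant digit, so in the inverse word the block `invRev p`
carries the top digits. The forward contribution of `t` is below `base ^ t.length ≤ base ^ r.length`
and cannot outweigh a difference in these digits. The weight thus compares the initial parts of
words with a common tail, serving as Nielsen's tie-breaker. -/
theorem numeral_le_of_symNumeral_le {p t r : List (α × Bool)} (hpt : p.length = t.length)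
    (hpr : p.length ≤ r.length) (h : symNumeral (p ++ r) ≤ symNumeral (t ++ r)) :
    numeral (invRev p) ≤ numeral (invRev t) := by
  simp only [symNumeral, invRev_append, numeral_append, invRev_length, hpt] at h
  by_contra hlt
  push Not at hlt
  have h1 := numeral_lt t
  have h2 : (Fintype.card (α × Bool) + 2) ^ t.length ≤ (Fintype.card (α × Bool) + 2) ^ r.length :=
    Nat.pow_le_pow_right (by omega) (hpt ▸ hpr)
  have h3 : (Fintype.card (α × Bool) + 2) ^ r.length * (numeral (invRev t) + 1) ≤
      (Fintype.card (α × Bool) + 2) ^ r.length * numeral (invRev p) := Nat.mul_le_mul_left _ hlt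
  rw [mul_add] at h3
  omega

end Weight

variable [DecidableEq α]

theorem exists_common_prefix (x y : FreeGroup α) :
    ∃ p a b, x.toWord = p ++ a ∧ y.toWord = p ++ b ∧ (x⁻¹ * y).toWord = invRev a ++ b := by
  obtain ⟨a, c, b, h1, h2, h3⟩ := IsReduced.exists_cancellation
    (isReduced_toWord (x := x⁻¹)) (isReduced_toWord (x := y))
  refine ⟨invRev c, invRev a, b, ?_, h2, ?_⟩
  · rw [← inv_inv x, toWord_inv, h1, invRev_append]
  · rw [invRev_invRev, toWord_mul, h1, h2, ← h3.reduce_eq]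
    apply reduce.sound
    simp only [← mul_mk, ← inv_mk]
    group

/-- The length of the longest common prefix of two reduced words. -/
def gromov (x y : FreeGroup α) : ℕ := (x.norm + y.norm - (x⁻¹ * y).norm) / 2

theorem exists_prefix_gromov (x y : FreeGroup α) :
    ∃ p a b, x.toWord = p ++ a ∧ y.toWord = p ++ b ∧ p.length = gromov x y ∧
      norm (x⁻¹ * y) + 2 * gromov x y = norm x + norm y := by
  obtain ⟨p, a, b, h1, h2, h3⟩ := exists_common_prefix x y
  have hx : norm x = p.length + a.length := by rw [norm, h1, List.length_append]
  have hy : norm y = p.length + b.length := by rw [norm, h2, List.length_append]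
  have hxy : norm (x⁻¹ * y) = a.length + b.length := by
    rw [norm, h3, List.length_append, invRev_length]
  have : p.length = gromov x y := by rw [gromov]; omega
  exact ⟨p, a, b, h1, h2, this, by omega⟩

theorem norm_add_gromov (x y : FreeGroup α) :
    norm (x⁻¹ * y) + 2 * gromov x y = norm x + norm y := by
  obtain ⟨_, _, _, -, -, -, h⟩ := exists_prefix_gromov x y
  exact h

theorem gromov_comm (x y : FreeGroup α) : gromov x y = gromov y x := by
  have h1 := norm_add_gromov x y
  have h2 := norm_add_gromov y x
  have : norm (y⁻¹ * x) = norm (x⁻¹ * y) := by rw [← norm_inv_eq]; simp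
  omega

theorem le_gromov {x y : FreeGroup α} {p : List (α × Bool)} (hx : p <+: x.toWord)
    (hy : p <+: y.toWord) : p.length ≤ gromov x y := by
  obtain ⟨a, ha⟩ := hx
  obtain ⟨b, hb⟩ := hy
  have h := norm_add_gromov x y
  have h1 : x⁻¹ * y = mk (invRev a ++ b) := by
    rw [← mk_toWord (x := x), ← mk_toWord (x := y), ← ha, ← hb]
    simp only [← mul_mk, ← inv_mk]
    group
  have h2 : norm (x⁻¹ * y) ≤ a.length + b.length := by
    rw [h1]
    simpa using norm_mk_le (L₁ := invRev a ++ b)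
  have hx : norm x = p.length + a.length := by rw [norm, ← ha, List.length_append]
  have hy : norm y = p.length + b.length := by rw [norm, ← hb, List.length_append]
  omega

/-- The two common prefixes are both prefixes of `z`, hence nested, and the shorter is common to `x`
and `y`. -/
theorem min_gromov_le (x y z : FreeGroup α) : min (gromov x z) (gromov z y) ≤ gromov x y := by
  obtain ⟨p, a, b, hx, hz, hp, -⟩ := exists_prefix_gromov x z
  obtain ⟨q, c, d, hz', hy, hq, -⟩ := exists_prefix_gromov z y
  have hp1 : p <+: z.toWord := ⟨b, hz.symm⟩
  have hq1 : q <+: z.toWord := ⟨c, hz'.symm⟩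
  have hp2 : p <+: x.toWord := ⟨a, hx.symm⟩
  have hq2 : q <+: y.toWord := ⟨d, hy.symm⟩
  rw [← hp, ← hq]
  rcases le_total p.length q.length with h | h
  · rw [min_eq_left h]
    exact le_gromov hp2 ((List.prefix_of_prefix_length_le hp1 hq1 h).trans hq2)
  · rw [min_eq_right h]
    exact le_gromov ((List.prefix_of_prefix_length_le hq1 hp1 h).trans hp2) hq2

theorem gromov_eq_of_lt {w z y : FreeGroup α} (h : gromov z y < gromov w z) :
    gromov w y = gromov z y := by
  have h1 := min_gromov_le w y z
  have h2 := min_gromov_le z y w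
  rw [gromov_comm z w] at h2
  omega

/-- Write `x` as a conjugate of its cyclically reduced core. Squaring repeats the nonempty core and
leaves the conjugator unchanged. -/
theorem norm_lt_norm_mul_self {x : FreeGroup α} (hx : x ≠ 1) : norm x < norm (x * x) := by
  have h1 := reduceCyclically.reduce_flatten_replicate_succ (isReduced_toWord (x := x)) 1
  have h2 := reduceCyclically.conj_conjugator_reduceCyclically x.toWord
  have hne : reduceCyclically x.toWord ≠ [] := by
    intro h
    apply hx
    rw [← mk_toWord (x := x), ← h2, h]
    rw [List.append_nil, ← mul_mk, ← inv_mk, mul_inv_cancel]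
  have h3 : norm (x * x) = _ := congrArg List.length ((toWord_mul x x).trans
    ((by simp : reduce (x.toWord ++ x.toWord) = reduce
      (List.replicate (1 + 1) x.toWord).flatten).trans h1))
  have h4 : norm x = _ := (congrArg List.length h2).symm
  have := List.length_pos_iff.2 hne
  simp at h3 h4
  omega

theorem toWord_mk_of_length_le {L : List (α × Bool)} (h : L.length ≤ norm (mk L)) :
    (mk L).toWord = L :=
  (Red.sublist (reduce.red (L := L))).eq_of_length_le h

/-- Two letters may be adjacent in a reduced word. -/
abbrev Adjacent (a b : α × Bool) : Prop := a.1 = b.1 → a.2 = b.2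

/-! ### Products of Nielsen reduced families -/

section Product

variable {ι β : Type*} [DecidableEq β] (U : ι × Bool → FreeGroup β)

/-- Neither neighbour cancels more than half of a factor, and the two together never exhaust it, so
each factor leaves at least one letter. The induction also carries that the cancellation of `U l₀`
with the whole product is decided by the first factor, and reserves the letters that `U l₀` may
still cancel. -/
theorem length_le_norm_prod (h0 : ∀ l, U l ≠ 1)
    (h1 : ∀ l₁ l₂, Adjacent l₁ l₂ → 2 * gromov (U l₁)⁻¹ (U l₂) ≤ norm (U l₂))
    (h2 : ∀ l₁ l₂ l₃, Adjacent l₁ l₂ → Adjacent l₂ l₃ →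
      gromov (U l₁)⁻¹ (U l₂) + gromov (U l₂)⁻¹ (U l₃) < norm (U l₂))
    (L : List (ι × Bool)) : ∀ l, IsReduced (l :: L) → ∀ l₀, Adjacent l₀ l →
      gromov (U l₀)⁻¹ (((l :: L).map U).prod) = gromov (U l₀)⁻¹ (U l) ∧
      L.length + 1 + gromov (U l₀)⁻¹ (U l) ≤ norm (((l :: L).map U).prod) := by
  induction L with
  | nil =>
    intro l _ l₀ hl
    have := h1 l₀ l hl
    have : norm (U l) ≠ 0 := fun h => h0 l (norm_eq_zero.1 h)
    simp
    omega
  | cons l' L ih =>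
    intro l hred l₀ hl
    have hll' : Adjacent l l' := (List.isChain_cons_cons.1 hred).1
    obtain ⟨ih1, ih2⟩ := ih l' (List.isChain_cons_cons.1 hred).2 l hll'
    have h3 := h2 l₀ l l' hl hll'
    rw [List.map_cons, List.prod_cons]
    set w' := ((l' :: L).map U).prod with hw'
    have h4 := norm_add_gromov (U l)⁻¹ w'
    rw [inv_inv, norm_inv_eq, ih1] at h4
    have h5 := norm_add_gromov (U l) (U l * w')
    rw [inv_mul_cancel_left] at h5
    refine ⟨?_, ?_⟩
    · rw [gromov_comm _ (U l * w'), gromov_comm _ (U l)]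
      apply gromov_eq_of_lt
      rw [gromov_comm _ (U l), gromov_comm (U l)]
      omega
    · simp only [List.length_cons]
      omega

end Product

/-! ### The complexity of an element and the tie-breaking argument -/

section Complexity

variable [Fintype α]

/-- The complexity of an element: word length, then the weight of the word. -/
noncomputable def complexity (x : FreeGroup α) : ℕ ×ₗ ℕ := toLex (norm x, symNumeral x.toWord)

theorem complexity_inv (x : FreeGroup α) : complexity x⁻¹ = complexity x := by
  simp [complexity, toWord_inv, symNumeral, add_comm]

theorem norm_le_of_complexity_le {x y : FreeGroup α} (h : complexity x ≤ complexity y) :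
    norm x ≤ norm y := by
  rcases Prod.Lex.toLex_le_toLex.1 h with h | h
  · exact h.le
  · exact h.1.le

theorem symNumeral_le_of_complexity_le {x y : FreeGroup α} (h : complexity x ≤ complexity y)
    (hn : norm x = norm y) : symNumeral x.toWord ≤ symNumeral y.toWord := by
  rcases Prod.Lex.toLex_le_toLex.1 h with h | h
  · exact absurd hn h.ne
  · exact h.2

/-- A half of `b` cannot be cancelled on both sides in `a * b * d` when none of the substitutions
`a ↦ a * b`, `d ↦ b * d` decreases the complexity. -/
theorem gromov_add_gromov_lt {a b d : FreeGroup α} (hb : b ≠ 1)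
    (ha1 : complexity a ≤ complexity (a * b)) (ha2 : norm b ≤ norm (a * b))
    (hd1 : complexity d ≤ complexity (b * d)) (hd2 : norm b ≤ norm (b * d)) :
    gromov a⁻¹ b + gromov b⁻¹ d < norm b := by
  obtain ⟨p, a', s, h1, h2, h3, h4⟩ := exists_prefix_gromov a⁻¹ b
  obtain ⟨q, s', d', h5, h6, h7, h8⟩ := exists_prefix_gromov b⁻¹ d
  rw [inv_inv, norm_inv_eq] at h4 h8
  have ha3 := norm_le_of_complexity_le ha1
  have hd3 := norm_le_of_complexity_le hd1
  -- Each cancellation is at most half of `b`, so failure means both are exactly half: `b = p * s`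
  -- with halves of equal length, `a⁻¹` begins with `p` and `d` with `s⁻¹`. Both substitutions then
  -- preserve length and only exchange these prefixes.
  by_contra hlt
  have hp : 2 * p.length = norm b := by omega
  have hq : 2 * q.length = norm b := by omega
  have hs : p.length + s.length = norm b := by rw [norm, h2, List.length_append]
  have ha' : p.length + a'.length = norm a := by
    rw [← norm_inv_eq, norm, h1, List.length_append]
  have hd' : q.length + d'.length = norm d := by rw [norm, h6, List.length_append]
  rw [toWord_inv, h2, invRev_append] at h5
  obtain ⟨hqs, -⟩ := List.append_inj h5 (by rw [invRev_length]; omega)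
  subst hqs
  rw [invRev_length] at hd' hq
  have eb : b = mk p * mk s := by rw [← mk_toWord (x := b), h2, mul_mk]
  have ea : a⁻¹ = mk p * mk a' := by rw [← mk_toWord (x := a⁻¹), h1, mul_mk]
  have ed : d = (mk s)⁻¹ * mk d' := by rw [← mk_toWord (x := d), h6, inv_mk, mul_mk]
  have e1 : (a * b)⁻¹ = mk (invRev s ++ a') := by
    rw [mul_inv_rev, ea, eb, ← mul_mk, ← inv_mk]
    group
  have e2 : b * d = mk (p ++ d') := by
    rw [ed, eb, ← mul_mk]
    group
  have n1 : norm (a * b) = norm a := by omega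
  have n2 : norm (b * d) = norm d := by omega
  have w1 : (a * b)⁻¹.toWord = invRev s ++ a' := by
    rw [e1]
    apply toWord_mk_of_length_le
    rw [← e1, norm_inv_eq, List.length_append, invRev_length]
    omega
  have w2 : (b * d).toWord = p ++ d' := by
    rw [e2]
    apply toWord_mk_of_length_le
    rw [← e2, List.length_append]
    omega
  rw [← complexity_inv a, ← complexity_inv (a * b)] at ha1
  have c1 := symNumeral_le_of_complexity_le ha1 (by rw [norm_inv_eq, norm_inv_eq, n1])
  -- The two weight comparisons go in opposite directions and force `invRev p = s`, so that `b = 1`.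
  -- The bounds `ha2` and `hd2` make the tails long enough for the comparison.
  have c2 := symNumeral_le_of_complexity_le hd1 n2.symm
  rw [h1, w1] at c1
  rw [h6, w2] at c2
  have l1 := numeral_le_of_symNumeral_le (by rw [invRev_length]; omega) (by omega) c1
  have l2 := numeral_le_of_symNumeral_le (by rw [invRev_length]; omega)
    (by rw [invRev_length]; omega) c2
  rw [invRev_invRev] at l1 l2
  have hps := numeral_inj (by rw [invRev_length]; omega) (le_antisymm l1 l2)
  apply hb
  rw [eb, ← hps, ← inv_mk, mul_inv_cancel]

end Complexity

end FreeGroup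

/-! ### Nielsen's theorem -/

namespace FreeGroup

variable {α : Type*}

/-- The element of the free group given by a letter. -/
def letter (l : α × Bool) : FreeGroup α := mk [l]

theorem letter_true (i : α) : letter (i, true) = of i := rfl

theorem letter_false (i : α) : letter (i, false) = (of i)⁻¹ := by
  simp [letter, of, inv_mk, invRev]

theorem letter_inv (i : α) (e : Bool) : (letter (i, e))⁻¹ = letter (i, !e) := by
  simp [letter, inv_mk, invRev]

theorem mk_eq_prod_letter (L : List (α × Bool)) : mk L = (L.map letter).prod := by
  induction L with
  | nil => rfl
  | cons a L ih => rw [List.map_cons, List.prod_cons, ← ih, letter, mul_mk]; rfl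

theorem mulAut_ext {f g : MulAut (FreeGroup α)} (h : ∀ i, f (of i) = g (of i)) : f = g :=
  MulEquiv.toMonoidHom_injective (ext_hom _ _ h)

/-- An automorphism sending every generator to a single letter lies in any subgroup containing the
sign changes and the permutations of the generators. -/
theorem mem_of_signed_perm [Finite α] [DecidableEq α] {N : Subgroup (MulAut (FreeGroup α))}
    (hε : ∀ i, ∃ ν ∈ N, ν (of i) = (of i)⁻¹ ∧ ∀ k, k ≠ i → ν (of k) = of k)
    (hσ : ∀ σ : Equiv.Perm α, (freeGroupCongr σ : MulAut (FreeGroup α)) ∈ N)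
    {ψ : MulAut (FreeGroup α)} (hψ : ∀ j, ∃ l, ψ (of j) = letter l) : ψ ∈ N := by
  cases nonempty_fintype α
  have hsign : ∀ (s : Finset α) (χ : MulAut (FreeGroup α)),
      (∀ j, χ (of j) = of j ∨ (j ∈ s ∧ χ (of j) = (of j)⁻¹)) → χ ∈ N := by
    intro s
    induction s using Finset.induction_on with
    | empty =>
      intro χ hχ
      have : χ = 1 := mulAut_ext fun j => by simpa using hχ j
      rw [this]
      exact N.one_mem
    | insert i s _ ih =>
      intro χ hχ
      by_cases hi : χ (of i) = of i
      · refine ih χ fun j => ?_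
        rcases hχ j with h | ⟨h, h'⟩
        · exact Or.inl h
        · rcases Finset.mem_insert.1 h with rfl | h
          · exact Or.inl hi
          · exact Or.inr ⟨h, h'⟩
      · obtain ⟨ν, hν, hνi, hνk⟩ := hε i
        have hχi : χ (of i) = (of i)⁻¹ := ((hχ i).resolve_left hi).2
        have : χ * ν ∈ N := by
          refine ih _ fun j => ?_
          by_cases hj : j = i
          · subst hj
            left
            rw [MulAut.mul_apply, hνi, _root_.map_inv, hχi, inv_inv]
          · rw [MulAut.mul_apply, hνk j hj]
            rcases hχ j with h | ⟨h, h'⟩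
            · exact Or.inl h
            · exact Or.inr ⟨Finset.mem_of_mem_insert_of_ne h hj, h'⟩
        exact (N.mul_mem_cancel_right hν).1 this
  choose l hl using hψ
  have hinj : Function.Injective fun j => (l j).1 := by
    intro i j hij
    have : ψ (of i) = ψ (of j) ∨ ψ (of i) = ψ (of j)⁻¹ := by
      have hj : l j = ((l i).1, (l j).2) := Prod.ext hij.symm rfl
      rw [_root_.map_inv, hl, hl, hj, letter_inv]
      generalize (l j).2 = e'
      obtain ⟨a, e⟩ := l i
      cases e <;> cases e' <;> simp
    rcases this with h | h
    · exact of_injective (ψ.injective h)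
    · have h2 := congrArg toWord (ψ.injective h)
      simp [toWord_inv, invRev] at h2
  let σ : Equiv.Perm α := Equiv.ofBijective _ (Finite.injective_iff_bijective.1 hinj)
  have hmem := hσ σ
  rw [← N.mul_mem_cancel_left (N.inv_mem hmem)]
  refine hsign Finset.univ _ fun j => ?_
  have h1 : ∀ j, (freeGroupCongr σ : MulAut (FreeGroup α))⁻¹ (of (σ j)) = of j := fun j => by
    have : (freeGroupCongr σ : MulAut (FreeGroup α)) (of j) = of (σ j) := by simp
    rw [← this, ← MulAut.mul_apply, inv_mul_cancel, MulAut.one_apply]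
  rw [MulAut.mul_apply, hl]
  have h2 : l j = (σ j, (l j).2) := rfl
  rw [h2]
  cases (l j).2
  · right
    rw [letter_false, _root_.map_inv, h1]
    exact ⟨Finset.mem_univ j, rfl⟩
  · left
    rw [letter_true, h1]

/-- The sign of `l'` is obtained by inverting the transvection, that of `l` by conjugating it with
the sign change at `l.1`, which yields multiplication on the left. -/
theorem exists_letter_mul {N : Subgroup (MulAut (FreeGroup α))}
    (hε : ∀ i, ∃ ν ∈ N, ν (of i) = (of i)⁻¹ ∧ ∀ k, k ≠ i → ν (of k) = of k)
    (hρ : ∀ i j, i ≠ j → ∃ ν ∈ N, ν (of i) = of i * of j ∧ ∀ k, k ≠ i → ν (of k) = of k)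
    (l l' : α × Bool) (hl : l.1 ≠ l'.1) :
    ∃ ν ∈ N, ν (letter l) = letter l * letter l' ∧ ∀ k, k ≠ l.1 → ν (of k) = of k := by
  obtain ⟨i, e⟩ := l
  obtain ⟨j, e'⟩ := l'
  replace hl : i ≠ j := hl
  have hpos : ∃ ν ∈ N, ν (of i) = of i * letter (j, e') ∧ ∀ k, k ≠ i → ν (of k) = of k := by
    obtain ⟨ν, hν, h1, h2⟩ := hρ i j hl
    cases e'
    · refine ⟨ν⁻¹, N.inv_mem hν, ?_, fun k hk => ?_⟩
      · rw [letter_false, MulAut.inv_apply, MulEquiv.symm_apply_eq, _root_.map_mul, _root_.map_inv, h1,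
          h2 j hl.symm, mul_inv_cancel_right]
      · rw [MulAut.inv_apply, MulEquiv.symm_apply_eq, h2 k hk]
    · exact ⟨ν, hν, h1, h2⟩
  cases e
  · obtain ⟨ν, hν, h1, h2⟩ := hpos
    obtain ⟨ε, hε, h3, h4⟩ := hε i
    have h5 : ε (letter (j, e')) = letter (j, e') := by
      cases e' <;> simp [letter_true, letter_false, h4 j hl.symm]
    refine ⟨ε * ν * ε, N.mul_mem (N.mul_mem hε hν) hε, ?_, fun k hk => ?_⟩
    · simp only [MulAut.mul_apply, letter_false, _root_.map_inv, h3, h1, h5, _root_.map_mul, inv_inv]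
    · simp only [MulAut.mul_apply, h4 k hk, h2 k hk]
  · exact hpos

/-- **Nielsen's theorem**: sign changes and permutations of the generators, together with the
transvections, generate the automorphism group of a free group of finite rank. -/
theorem eq_top_of_nielsen [Finite α] [DecidableEq α] {N : Subgroup (MulAut (FreeGroup α))}
    (hε : ∀ i, ∃ ν ∈ N, ν (of i) = (of i)⁻¹ ∧ ∀ k, k ≠ i → ν (of k) = of k)
    (hσ : ∀ σ : Equiv.Perm α, (freeGroupCongr σ : MulAut (FreeGroup α)) ∈ N)
    (hρ : ∀ i j, i ≠ j → ∃ ν ∈ N, ν (of i) = of i * of j ∧ ∀ k, k ≠ i → ν (of k) = of k) :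
    N = ⊤ := by
  cases nonempty_fintype α
  rw [Subgroup.eq_top_iff']
  intro φ₀
  -- Choose in the coset `φ₀ N` an automorphism for which the total complexity of the images of the
  -- generators is least.
  obtain ⟨φ, ⟨ν₀, hν₀, rfl⟩, hmin⟩ := WellFounded.has_min
    (InvImage.wf (fun φ : MulAut (FreeGroup α) => ∑ i, complexity (φ (of i)))
      (wellFounded_lt (α := ℕ ×ₗ ℕ)))
    {φ | ∃ ν ∈ N, φ = φ₀ * ν} ⟨φ₀, 1, N.one_mem, (mul_one _).symm⟩
  rw [← N.mul_mem_cancel_right hν₀]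
  set φ := φ₀ * ν₀ with hφ
  let U : α × Bool → FreeGroup α := fun l => φ (letter l)
  have hUinv : ∀ i e, (U (i, e))⁻¹ = U (i, !e) := fun i e => by
    simp only [U, ← _root_.map_inv, letter_inv]
  have hU0 : ∀ l, U l ≠ 1 := fun l h => by
    have h' : letter l = 1 := φ.injective (h.trans (_root_.map_one φ).symm)
    obtain ⟨i, e⟩ := l
    cases e
    · rw [letter_false, inv_eq_one] at h'
      exact of_ne_one _ h'
    · exact of_ne_one _ h'
  have hUc : ∀ i e, complexity (U (i, e)) = complexity (U (i, true)) := fun i e => by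
    cases e
    · rw [← complexity_inv, hUinv]
      rfl
    · rfl
  -- Otherwise a Nielsen move would lower one term of the sum and leave the others unchanged.
  have hright : ∀ l l' : α × Bool, l.1 ≠ l'.1 → complexity (U l) ≤ complexity (U l * U l') := by
    intro l l' hl
    obtain ⟨ν, hν, h1, h2⟩ := exists_letter_mul hε hρ l l' hl
    have := hmin (φ * ν) ⟨ν₀ * ν, N.mul_mem hν₀ hν, by rw [hφ, mul_assoc]⟩
    by_contra hlt
    push Not at hlt
    apply this
    have e1 : complexity (φ (of l.1)) = complexity (U l) := (hUc l.1 l.2).symm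
    have e2 : complexity ((φ * ν) (of l.1)) = complexity (U l * U l') := by
      have : U l * U l' = (φ * ν) (letter l) := by rw [MulAut.mul_apply, h1, _root_.map_mul]
      rw [this]
      obtain ⟨i, e⟩ := l
      cases e
      · rw [letter_false, _root_.map_inv, complexity_inv]
      · rfl
    refine Finset.sum_lt_sum (fun k _ => ?_) ⟨l.1, Finset.mem_univ _, by rwa [e1, e2]⟩
    by_cases hk : k = l.1
    · rw [hk, e1, e2]
      exact hlt.le
    · rw [MulAut.mul_apply, h2 k hk]
  have hleft : ∀ l l' : α × Bool, l.1 ≠ l'.1 → complexity (U l') ≤ complexity (U l * U l') := by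
    rintro ⟨i, e⟩ ⟨j, e'⟩ hl
    have := hright (j, !e') (i, !e) hl.symm
    rwa [← hUinv, ← hUinv, ← mul_inv_rev, complexity_inv, complexity_inv] at this
  have hself : ∀ l, 2 * gromov (U l)⁻¹ (U l) < norm (U l) := fun l => by
    have h1 := norm_lt_norm_mul_self (hU0 l)
    have h2 := norm_add_gromov (U l)⁻¹ (U l)
    rw [inv_inv, norm_inv_eq] at h2
    omega
  have hadj : ∀ l l' : α × Bool, Adjacent l l' → l.1 = l'.1 → l = l' := fun l l' h h' =>
    Prod.ext h' (h h')
  have hhalf : ∀ l l', Adjacent l l' → 2 * gromov (U l)⁻¹ (U l') ≤ norm (U l') ∧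
      2 * gromov (U l)⁻¹ (U l') ≤ norm (U l) := by
    intro l l' hll'
    by_cases h : l.1 = l'.1
    · obtain rfl := hadj l l' hll' h
      exact ⟨(hself l).le, (hself l).le⟩
    · have h1 := norm_le_of_complexity_le (hright l l' h)
      have h2 := norm_le_of_complexity_le (hleft l l' h)
      have h3 := norm_add_gromov (U l)⁻¹ (U l')
      rw [inv_inv, norm_inv_eq] at h3
      omega
  have htriple : ∀ l₁ l₂ l₃, Adjacent l₁ l₂ → Adjacent l₂ l₃ →
      gromov (U l₁)⁻¹ (U l₂) + gromov (U l₂)⁻¹ (U l₃) < norm (U l₂) := by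
    intro l₁ l₂ l₃ h12 h23
    have a1 := (hhalf l₁ l₂ h12).1
    have a2 := (hhalf l₂ l₃ h23).2
    by_cases h : l₁.1 = l₂.1
    · obtain rfl := hadj l₁ l₂ h12 h
      have := hself l₁
      omega
    by_cases h' : l₂.1 = l₃.1
    · obtain rfl := hadj l₂ l₃ h23 h'
      have := hself l₂
      omega
    exact gromov_add_gromov_lt (hU0 l₂) (hright l₁ l₂ h)
      (norm_le_of_complexity_le (hleft l₁ l₂ h)) (hleft l₂ l₃ h')
      (norm_le_of_complexity_le (hright l₂ l₃ h'))
  -- The inverse is the automorphism to control: if `φ w` is a generator, it has length one, and `w`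
  -- is no longer than that.
  rw [← N.inv_mem_iff]
  refine mem_of_signed_perm hε hσ fun j => ?_
  set w := φ⁻¹ (of j) with hw
  have hφw : φ w = of j := by rw [hw, ← MulAut.mul_apply, mul_inv_cancel, MulAut.one_apply]
  have hprod : φ w = (w.toWord.map U).prod := by
    conv_lhs => rw [← mk_toWord (x := w), mk_eq_prod_letter, map_list_prod, List.map_map]
    rfl
  have hred := isReduced_toWord (x := w)
  rcases hcase : w.toWord with - | ⟨l, L⟩
  · rw [toWord_eq_nil_iff] at hcase
    rw [hcase, _root_.map_one] at hφw
    exact absurd hφw.symm (of_ne_one j)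
  · rw [hcase] at hred hprod
    -- The letter `l` serves as its own admissible predecessor; only the length bound is needed.
    have := (length_le_norm_prod U hU0 (fun l₁ l₂ h => (hhalf l₁ l₂ h).1) htriple L l hred l
      (fun _ => rfl)).2
    rw [← hprod, hφw, norm_of] at this
    have hL : L = [] := List.length_eq_zero_iff.1 (by omega)
    exact ⟨l, by rw [← mk_toWord (x := w), hcase, hL]; rfl⟩

end FreeGroup

theorem pow_mul_swap {G : Type*} [Group G] {s t : G} (hs : s ^ 2 = 1) (ht : t ^ 2 = 1) {m : ℕ}
    (h : (s * t) ^ m = 1) : (t * s) ^ m = 1 := by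
  have hs' : s⁻¹ = s := inv_eq_of_mul_eq_one_left (by rw [← pow_two, hs])
  have ht' : t⁻¹ = t := inv_eq_of_mul_eq_one_left (by rw [← pow_two, ht])
  have : t * s = (s * t)⁻¹ := by rw [mul_inv_rev, hs', ht']
  rw [this, inv_pow, h, inv_one]

theorem pow_eq_one_of_dvd {G : Type*} [Group G] {s : G} {m k : ℕ} (hm : m ∣ k)
    (h : s ^ m = 1) : s ^ k = 1 := by
  obtain ⟨j, rfl⟩ := hm
  rw [pow_mul, h, one_pow]

/-! ### Involutions generating the automorphism group of a free group -/

namespace FreeGroup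

variable {α : Type*}

/-- The involutive automorphism given by the images of the generators. -/
def ofInvolution (f : α → FreeGroup α) (h : ∀ i, lift f (f i) = of i) : MulAut (FreeGroup α) :=
  MonoidHom.toMulEquiv (lift f) (lift f) (ext_hom _ _ fun i => by simpa using h i)
    (ext_hom _ _ fun i => by simpa using h i)

@[simp]
theorem ofInvolution_of (f : α → FreeGroup α) (h : ∀ i, lift f (f i) = of i) (i : α) :
    ofInvolution f h (of i) = f i := by
  simp [ofInvolution]

theorem ofInvolution_sq (f : α → FreeGroup α) (h : ∀ i, lift f (f i) = of i) :
    ofInvolution f h ^ 2 = 1 := by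
  refine mulAut_ext fun i => ?_
  rw [pow_two, MulAut.mul_apply, ofInvolution_of]
  simpa [ofInvolution] using h i

variable [DecidableEq α] (a b c : α)

/-- `a ↦ a * b`, `b ↦ b⁻¹`. -/
def foldFun (i : α) : FreeGroup α :=
  if i = a then of a * of b else if i = b then (of b)⁻¹ else of i

/-- `a ↦ b⁻¹`, `b ↦ a⁻¹`. -/
def flipFun (i : α) : FreeGroup α :=
  if i = a then (of b)⁻¹ else if i = b then (of a)⁻¹ else of i

/-- `a ↦ a⁻¹`, `b ↦ c`, `c ↦ b`. -/
def turnFun (i : α) : FreeGroup α :=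
  if i = a then (of a)⁻¹ else if i = b then of c else if i = c then of b else of i

/-- `c ↦ c⁻¹`. -/
def signFun (i : α) : FreeGroup α := if i = c then (of c)⁻¹ else of i

/-- `c ↦ k`, `k ↦ c`. -/
def swapFun (k i : α) : FreeGroup α :=
  if i = c then of k else if i = k then of c else of i

variable {a b c} (hab : a ≠ b) (hac : a ≠ c) (hbc : b ≠ c)

/-- The involution given by `foldFun`. -/
def foldAut : MulAut (FreeGroup α) := ofInvolution (foldFun a b) fun i => by
  have := hab.symm
  by_cases h1 : i = a <;> by_cases h2 : i = b <;> simp_all [foldFun]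

/-- The involution given by `flipFun`. -/
def flipAut : MulAut (FreeGroup α) := ofInvolution (flipFun a b) fun i => by
  have := hab.symm
  by_cases h1 : i = a <;> by_cases h2 : i = b <;> simp_all [flipFun]

/-- The involution given by `turnFun`. -/
def turnAut : MulAut (FreeGroup α) := ofInvolution (turnFun a b c) fun i => by
  have := hab.symm
  have := hac.symm
  have := hbc.symm
  by_cases h1 : i = a <;> by_cases h2 : i = b <;> by_cases h3 : i = c <;> simp_all [turnFun]

variable (c) in
/-- The involution given by `signFun`. -/
def signAut : MulAut (FreeGroup α) := ofInvolution (signFun c) fun i => by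
  by_cases h1 : i = c <;> simp_all [signFun]

variable (c) in
/-- The involution given by `swapFun`. -/
def swapAut (k : α) : MulAut (FreeGroup α) := ofInvolution (swapFun c k) fun i => by
  by_cases h1 : i = c <;> by_cases h2 : i = k <;> simp_all [swapFun]

theorem foldAut_flipAut : (foldAut hab * flipAut hab) ^ 3 = 1 := by
  have := hab.symm
  refine mulAut_ext fun i => ?_
  by_cases h1 : i = a <;> by_cases h2 : i = b <;>
    simp_all [pow_succ, foldAut, flipAut, foldFun, flipFun, mul_assoc]

theorem foldAut_turnAut : (foldAut hab * turnAut hab hac hbc) ^ 4 = 1 := by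
  have := hab.symm
  have := hac.symm
  have := hbc.symm
  refine mulAut_ext fun i => ?_
  by_cases h1 : i = a <;> by_cases h2 : i = b <;> by_cases h3 : i = c <;>
    simp_all [pow_succ, foldAut, turnAut, foldFun, turnFun, mul_assoc]

theorem foldAut_signAut (hac : a ≠ c) (hbc : b ≠ c) : (foldAut hab * signAut c) ^ 2 = 1 := by
  have := hab.symm
  have := hac.symm
  have := hbc.symm
  refine mulAut_ext fun i => ?_
  by_cases h1 : i = a <;> by_cases h2 : i = b <;> by_cases h3 : i = c <;>
    simp_all [pow_succ, foldAut, signAut, foldFun, signFun, mul_assoc]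

theorem flipAut_signAut (hac : a ≠ c) (hbc : b ≠ c) : (flipAut hab * signAut c) ^ 2 = 1 := by
  have := hab.symm
  have := hac.symm
  have := hbc.symm
  refine mulAut_ext fun i => ?_
  by_cases h1 : i = a <;> by_cases h2 : i = b <;> by_cases h3 : i = c <;>
    simp_all [pow_succ, flipAut, signAut, flipFun, signFun, mul_assoc]

theorem flipAut_turnAut : (flipAut hab * turnAut hab hac hbc) ^ 6 = 1 := by
  have := hab.symm
  have := hac.symm
  have := hbc.symm
  refine mulAut_ext fun i => ?_
  by_cases h1 : i = a <;> by_cases h2 : i = b <;> by_cases h3 : i = c <;>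
    simp_all [pow_succ, flipAut, turnAut, flipFun, turnFun, mul_assoc]

theorem turnAut_signAut : (turnAut hab hac hbc * signAut c) ^ 4 = 1 := by
  have := hab.symm
  have := hac.symm
  have := hbc.symm
  refine mulAut_ext fun i => ?_
  by_cases h1 : i = a <;> by_cases h2 : i = b <;> by_cases h3 : i = c <;>
    simp_all [pow_succ, signAut, turnAut, signFun, turnFun, mul_assoc]

theorem foldAut_swapAut (hac : a ≠ c) (hbc : b ≠ c) {k : α} (hka : k ≠ a) (hkb : k ≠ b)
    (hkc : k ≠ c) : (foldAut hab * swapAut c k) ^ 2 = 1 := by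
  have := hab.symm
  have := hac.symm
  have := hbc.symm
  have := hka.symm
  have := hkb.symm
  have := hkc.symm
  refine mulAut_ext fun i => ?_
  by_cases h1 : i = a <;> by_cases h2 : i = b <;> by_cases h3 : i = c <;> by_cases h4 : i = k <;>
    simp_all [pow_succ, foldAut, swapAut, foldFun, swapFun, mul_assoc]

theorem flipAut_swapAut (hac : a ≠ c) (hbc : b ≠ c) {k : α} (hka : k ≠ a) (hkb : k ≠ b)
    (hkc : k ≠ c) : (flipAut hab * swapAut c k) ^ 2 = 1 := by
  have := hab.symm
  have := hac.symm
  have := hbc.symm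
  have := hka.symm
  have := hkb.symm
  have := hkc.symm
  refine mulAut_ext fun i => ?_
  by_cases h1 : i = a <;> by_cases h2 : i = b <;> by_cases h3 : i = c <;> by_cases h4 : i = k <;>
    simp_all [pow_succ, flipAut, swapAut, flipFun, swapFun, mul_assoc]

theorem turnAut_swapAut {k : α} (hka : k ≠ a) (hkb : k ≠ b)
    (hkc : k ≠ c) : (turnAut hab hac hbc * swapAut c k) ^ 6 = 1 := by
  have := hab.symm
  have := hac.symm
  have := hbc.symm
  have := hka.symm
  have := hkb.symm
  have := hkc.symm
  refine mulAut_ext fun i => ?_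
  by_cases h1 : i = a <;> by_cases h2 : i = b <;> by_cases h3 : i = c <;> by_cases h4 : i = k <;>
    simp_all [pow_succ, turnAut, swapAut, turnFun, swapFun, mul_assoc]

theorem signAut_swapAut {k : α} (hkc : k ≠ c) : (signAut c * swapAut c k) ^ 4 = 1 := by
  have := hkc.symm
  refine mulAut_ext fun i => ?_
  by_cases h3 : i = c <;> by_cases h4 : i = k <;>
    simp_all [pow_succ, signAut, swapAut, signFun, swapFun]

theorem swapAut_swapAut {k l : α} (hkc : k ≠ c) (hlc : l ≠ c) (hkl : k ≠ l) :
    (swapAut c k * swapAut c l) ^ 3 = 1 := by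
  have := hkc.symm
  have := hlc.symm
  have := hkl.symm
  refine mulAut_ext fun i => ?_
  by_cases h3 : i = c <;> by_cases h4 : i = k <;> by_cases h5 : i = l <;>
    simp_all [pow_succ, swapAut, swapFun]

/-- A set of involutions generating `MulAut (FreeGroup α)`. -/
def involutions : Set (MulAut (FreeGroup α)) :=
  {foldAut hab, flipAut hab, turnAut hab hac hbc, signAut c} ∪
    {g | ∃ k, (k ≠ a ∧ k ≠ b ∧ k ≠ c) ∧ swapAut c k = g}

theorem involutions_finite [Finite α] : (involutions hab hac hbc).Finite := by
  refine Set.Finite.union (by simp) ?_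
  exact (Set.finite_range (swapAut c)).subset fun g ⟨k, _, hk⟩ => ⟨k, hk⟩

theorem sq_of_mem_involutions {s : MulAut (FreeGroup α)} (hs : s ∈ involutions hab hac hbc) :
    s ^ 2 = 1 := by
  rcases hs with (rfl | rfl | rfl | rfl) | ⟨k, -, rfl⟩ <;> exact ofInvolution_sq _ _

theorem pow_of_mem_involutions {s t : MulAut (FreeGroup α)} (hs : s ∈ involutions hab hac hbc)
    (ht : t ∈ involutions hab hac hbc) : (s * t) ^ 24 = 1 := by
  have hs2 := sq_of_mem_involutions hab hac hbc hs
  have ht2 := sq_of_mem_involutions hab hac hbc ht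
  have hself : ∀ s : MulAut (FreeGroup α), s ^ 2 = 1 → (s * s) ^ 24 = 1 := fun s hs => by
    rw [← pow_two, hs, one_pow]
  have e2 : 2 ∣ 24 := by norm_num
  have e3 : 3 ∣ 24 := by norm_num
  have e4 : 4 ∣ 24 := by norm_num
  have e6 : 6 ∣ 24 := by norm_num
  rcases hs with (rfl | rfl | rfl | rfl) | ⟨k, ⟨ka, kb, kc⟩, rfl⟩ <;>
    rcases ht with (rfl | rfl | rfl | rfl) | ⟨l, ⟨la, lb, lc⟩, rfl⟩
  · exact hself _ hs2
  · exact pow_eq_one_of_dvd e3 (foldAut_flipAut hab)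
  · exact pow_eq_one_of_dvd e4 (foldAut_turnAut hab hac hbc)
  · exact pow_eq_one_of_dvd e2 (foldAut_signAut hab hac hbc)
  · exact pow_eq_one_of_dvd e2 (foldAut_swapAut hab hac hbc la lb lc)
  · exact pow_mul_swap ht2 hs2 (pow_eq_one_of_dvd e3 (foldAut_flipAut hab))
  · exact hself _ hs2
  · exact pow_eq_one_of_dvd e6 (flipAut_turnAut hab hac hbc)
  · exact pow_eq_one_of_dvd e2 (flipAut_signAut hab hac hbc)
  · exact pow_eq_one_of_dvd e2 (flipAut_swapAut hab hac hbc la lb lc)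
  · exact pow_mul_swap ht2 hs2 (pow_eq_one_of_dvd e4 (foldAut_turnAut hab hac hbc))
  · exact pow_mul_swap ht2 hs2 (pow_eq_one_of_dvd e6 (flipAut_turnAut hab hac hbc))
  · exact hself _ hs2
  · exact pow_eq_one_of_dvd e4 (turnAut_signAut hab hac hbc)
  · exact pow_eq_one_of_dvd e6 (turnAut_swapAut hab hac hbc la lb lc)
  · exact pow_mul_swap ht2 hs2 (pow_eq_one_of_dvd e2 (foldAut_signAut hab hac hbc))
  · exact pow_mul_swap ht2 hs2 (pow_eq_one_of_dvd e2 (flipAut_signAut hab hac hbc))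
  · exact pow_mul_swap ht2 hs2 (pow_eq_one_of_dvd e4 (turnAut_signAut hab hac hbc))
  · exact hself _ hs2
  · exact pow_eq_one_of_dvd e4 (signAut_swapAut lc)
  · exact pow_mul_swap ht2 hs2 (pow_eq_one_of_dvd e2 (foldAut_swapAut hab hac hbc ka kb kc))
  · exact pow_mul_swap ht2 hs2 (pow_eq_one_of_dvd e2 (flipAut_swapAut hab hac hbc ka kb kc))
  · exact pow_mul_swap ht2 hs2 (pow_eq_one_of_dvd e6 (turnAut_swapAut hab hac hbc ka kb kc))
  · exact pow_mul_swap ht2 hs2 (pow_eq_one_of_dvd e4 (signAut_swapAut kc))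
  · by_cases hkl : k = l
    · subst hkl
      exact hself _ hs2
    · exact pow_eq_one_of_dvd e3 (swapAut_swapAut kc lc hkl)

/-- Permutations of the generators as automorphisms. -/
def permHom (α : Type*) : Equiv.Perm α →* MulAut (FreeGroup α) where
  toFun σ := freeGroupCongr σ
  map_one' := mulAut_ext fun i => by simp
  map_mul' σ τ := mulAut_ext fun i => by simp [MulAut.mul_apply]

@[simp]
theorem permHom_of {α : Type*} (σ : Equiv.Perm α) (i : α) : permHom α σ (of i) = of (σ i) := by
  simp [permHom]

theorem permHom_swap (k : α) : permHom α (Equiv.swap c k) = swapAut c k := by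
  refine mulAut_ext fun i => ?_
  by_cases h1 : i = c <;> by_cases h2 : i = k <;>
    simp_all [swapAut, swapFun, Equiv.swap_apply_of_ne_of_ne]

/-- Conjugating `signAut c` gives all sign changes; removing signs from `turnAut` and `flipAut`
leaves transpositions, and the transpositions with `c` generate all permutations. Finally `foldAut
hab * signAut b` is a transvection, and permutations conjugate it to all the others. -/
theorem closure_involutions [Finite α] : Subgroup.closure (involutions hab hac hbc) = ⊤ := by
  set N := Subgroup.closure (involutions hab hac hbc) with hN
  have hba := hab.symm
  have hca := hac.symm
  have hcb := hbc.symm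
  have hfold : foldAut hab ∈ N := Subgroup.subset_closure (by simp [involutions])
  have hflip : flipAut hab ∈ N := Subgroup.subset_closure (by simp [involutions])
  have hturn : turnAut hab hac hbc ∈ N := Subgroup.subset_closure (by simp [involutions])
  have hsc : signAut c ∈ N := Subgroup.subset_closure (by simp [involutions])
  have hswap : ∀ k, k ≠ a → k ≠ b → k ≠ c → swapAut c k ∈ N := fun k h1 h2 h3 =>
    Subgroup.subset_closure (Or.inr ⟨k, ⟨h1, h2, h3⟩, rfl⟩)
  have hsb : signAut b ∈ N := by
    have : signAut b = turnAut hab hac hbc * signAut c * turnAut hab hac hbc := by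
      refine mulAut_ext fun i => ?_
      by_cases h1 : i = a <;> by_cases h2 : i = b <;> by_cases h3 : i = c <;>
        simp_all [turnAut, signAut, turnFun, signFun]
    rw [this]
    exact N.mul_mem (N.mul_mem hturn hsc) hturn
  have hsa : signAut a ∈ N := by
    have : signAut a = flipAut hab * signAut b * flipAut hab := by
      refine mulAut_ext fun i => ?_
      by_cases h1 : i = a <;> by_cases h2 : i = b <;>
        simp_all [flipAut, signAut, flipFun, signFun]
    rw [this]
    exact N.mul_mem (N.mul_mem hflip hsb) hflip
  have hs : ∀ k, signAut k ∈ N := by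
    intro k
    by_cases hka : k = a
    · rwa [hka]
    by_cases hkb : k = b
    · rwa [hkb]
    by_cases hkc : k = c
    · rwa [hkc]
    have hck := Ne.symm hkc
    have : signAut k = swapAut c k * signAut c * swapAut c k := by
      refine mulAut_ext fun i => ?_
      by_cases h1 : i = c <;> by_cases h2 : i = k <;>
        simp_all [swapAut, signAut, swapFun, signFun]
    rw [this]
    exact N.mul_mem (N.mul_mem (hswap k hka hkb hkc) hsc) (hswap k hka hkb hkc)
  have hcbmem : swapAut c b ∈ N := by
    have : swapAut c b = turnAut hab hac hbc * signAut a := by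
      refine mulAut_ext fun i => ?_
      by_cases h1 : i = a <;> by_cases h2 : i = b <;> by_cases h3 : i = c <;>
        simp_all [turnAut, signAut, swapAut, turnFun, signFun, swapFun]
    rw [this]
    exact N.mul_mem hturn hsa
  have habmem : swapAut a b ∈ N := by
    have : swapAut a b = flipAut hab * signAut a * signAut b := by
      refine mulAut_ext fun i => ?_
      by_cases h1 : i = a <;> by_cases h2 : i = b <;>
        simp_all [flipAut, signAut, swapAut, flipFun, signFun, swapFun]
    rw [this]
    exact N.mul_mem (N.mul_mem hflip hsa) hsb
  have hca : swapAut c a ∈ N := by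
    have : swapAut c a = swapAut c b * swapAut a b * swapAut c b := by
      simp only [← permHom_swap, ← _root_.map_mul]
      congr 1
      rw [Equiv.swap_comm c b, Equiv.swap_mul_swap_mul_swap hab hac]
    rw [this]
    exact N.mul_mem (N.mul_mem hcbmem habmem) hcbmem
  have hck : ∀ k, Equiv.swap c k ∈ N.comap (permHom α) := by
    intro k
    rw [Subgroup.mem_comap, permHom_swap]
    by_cases hka : k = a
    · rwa [hka]
    by_cases hkb : k = b
    · rwa [hkb]
    by_cases hkc : k = c
    · have : swapAut c k = 1 := by rw [hkc, ← permHom_swap, Equiv.swap_self]; exact (permHom α).map_one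
      rw [this]
      exact N.one_mem
    exact hswap k hka hkb hkc
  have hperm : ∀ σ, permHom α σ ∈ N := by
    have : N.comap (permHom α) = ⊤ := by
      rw [eq_top_iff, ← Equiv.Perm.closure_isSwap, Subgroup.closure_le]
      rintro _ ⟨x, y, hxy, rfl⟩
      by_cases hx : x = c
      · rw [hx]
        exact hck y
      by_cases hy : y = c
      · rw [hy, Equiv.swap_comm]
        exact hck x
      rw [SetLike.mem_coe, ← Equiv.swap_mul_swap_mul_swap hy hxy.symm]
      have hyc := hck y
      rw [Equiv.swap_comm] at hyc
      exact Subgroup.mul_mem _ (Subgroup.mul_mem _ (hck x) hyc) (hck x)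
    intro σ
    exact Subgroup.mem_comap.1 (this ▸ Subgroup.mem_top σ)
  refine eq_top_of_nielsen (fun i => ⟨signAut i, hs i, ?_, fun k hk => ?_⟩) hperm ?_
  · simp [signAut, signFun]
  · simp [signAut, signFun, hk]
  · intro i j hij
    -- A permutation taking `a` to `i` and `b` to `j`: first move `a` to `i`, then the current image
    -- of `b` to `j`, which leaves `i` in place.
    let σ : Equiv.Perm α := Equiv.swap (Equiv.swap a i b) j * Equiv.swap a i
    have hx : Equiv.swap a i b ≠ i := fun h => hba (by
      rw [← Equiv.swap_apply_left a i] at h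
      exact (Equiv.swap a i).injective (by simpa using h))
    have hσa : σ a = i := by simp [σ, Equiv.swap_apply_of_ne_of_ne hx.symm hij]
    have hσb : σ b = j := by simp [σ]
    have hinv : ∀ m, (permHom α σ)⁻¹ (of (σ m)) = of m := fun m => by
      rw [← permHom_of, ← MulAut.mul_apply, inv_mul_cancel, MulAut.one_apply]
    refine ⟨permHom α σ * (foldAut hab * signAut b) * (permHom α σ)⁻¹,
      N.mul_mem (N.mul_mem (hperm σ) (N.mul_mem hfold hsb)) (N.inv_mem (hperm σ)), ?_,
      fun k hk => ?_⟩
    · rw [← hσa, ← hσb]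
      simp only [MulAut.mul_apply, hinv]
      simp [foldAut, signAut, foldFun, signFun, hab]
    · obtain ⟨m, rfl⟩ := σ.surjective k
      have hma : m ≠ a := fun h => hk (by rw [h, hσa])
      simp only [MulAut.mul_apply, hinv]
      by_cases hmb : m = b
      · simp [hmb, hba, foldAut, signAut, foldFun, signFun]
      · simp [hma, hmb, foldAut, signAut, foldFun, signFun]

end FreeGroup

/-! ### Transvections generate the special linear group over the integers -/

namespace Matrix.SpecialLinearGroup

section RowOperation

variable {ι : Type*} [Fintype ι] [DecidableEq ι]

theorem transvection_mul_apply {i j : ι} (hij : i ≠ j) (t : ℤ) (A : SpecialLinearGroup ι ℤ)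
    (r s : ι) : (transvection hij t * A) r s = if r = i then A i s + t * A j s else A r s := by
  split_ifs with h
  · subst h
    exact Matrix.transvection_mul_apply_same r j s t A.1
  · exact Matrix.transvection_mul_apply_of_ne i j r s h t A.1

theorem transvection_mem {N : Subgroup (SpecialLinearGroup ι ℤ)}
    (hN : ∀ (i j : ι) (hij : i ≠ j), transvection hij 1 ∈ N) {i j : ι} (hij : i ≠ j) (t : ℤ) :
    transvection hij t ∈ N := by
  have hadd : ∀ s t : ℤ, transvection hij s * transvection hij t = transvection hij (s + t) :=
    fun s t => Subtype.ext (Matrix.transvection_mul_transvection_same _ _ hij s t)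
  have hzero : transvection hij (0 : ℤ) = 1 := Subtype.ext (Matrix.transvection_zero i j)
  induction t with
  | zero => rw [hzero]; exact N.one_mem
  | succ t ih => rw [← hadd]; exact N.mul_mem ih (hN i j hij)
  | pred t ih =>
    have h : (transvection hij (1 : ℤ))⁻¹ = transvection hij (-1) :=
      inv_eq_of_mul_eq_one_right (by rw [hadd, add_neg_cancel, hzero])
    rw [sub_eq_add_neg, ← hadd, ← h]
    exact N.mul_mem ih (N.inv_mem (hN i j hij))

end RowOperation

variable {n : ℕ}

/-- The first `k` columns of `A` are those of the identity matrix. -/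
def StandardColumns (k : ℕ) (A : SpecialLinearGroup (Fin n) ℤ) : Prop :=
  ∀ i j : Fin n, (j : ℕ) < k → A i j = (1 : Matrix (Fin n) (Fin n) ℤ) i j

theorem StandardColumns.transvection_mul {k : ℕ} {A : SpecialLinearGroup (Fin n) ℤ}
    (hA : StandardColumns k A) {i j : Fin n} (hij : i ≠ j) (hj : k ≤ j) (t : ℤ) :
    StandardColumns k (transvection hij t * A) := by
  intro r s hs
  have h : A j s = 0 := by
    rw [hA j s hs, Matrix.one_apply_ne]
    rintro rfl
    omega
  rw [transvection_mul_apply, h, mul_zero, add_zero]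
  split_ifs with hr
  · rw [hr, hA i s hs]
  · exact hA r s hs

/-- The entries of the `k`-th column below the standard columns are coprime. -/
theorem StandardColumns.sum_eq_one {k : Fin n} {A : SpecialLinearGroup (Fin n) ℤ}
    (hA : StandardColumns k A) : ∑ i, (if k ≤ i then A⁻¹ k i * A i k else 0) = 1 := by
  have h1 : ∀ j, ∑ i, A⁻¹ k i * A i j = (1 : Matrix (Fin n) (Fin n) ℤ) k j := fun j => by
    rw [← Matrix.mul_apply, ← coe_mul, inv_mul_cancel, coe_one]
  refine Eq.trans (Finset.sum_congr rfl fun i _ => ?_) ((h1 k).trans (Matrix.one_apply_eq k))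
  split_ifs with hi
  · rfl
  · push Not at hi
    -- For `i < k` column `i` of `A` is a basis vector, so entry `(k, i)` of `A⁻¹ * A = 1` says that
    -- `A⁻¹ k i = 0`.
    have h2 := h1 i
    have h3 : ∀ l, A⁻¹ k l * A l i = if l = i then A⁻¹ k i else 0 := fun l => by
      rw [hA l i hi, Matrix.one_apply]
      split_ifs with h <;> simp [h]
    simp only [h3] at h2
    rw [Finset.sum_ite_eq' Finset.univ i, if_pos (Finset.mem_univ i),
      Matrix.one_apply_ne hi.ne'] at h2
    rw [h2, zero_mul]

/-- Row operations using only rows from `k` on keep the earlier columns. Minimising the absolute sum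
of the remaining part of column `k` leaves one nonzero entry, a unit by
`StandardColumns.sum_eq_one`; it is turned into a pivot `1`, which clears the column. -/
theorem exists_standardColumns_succ {N : Subgroup (SpecialLinearGroup (Fin n) ℤ)}
    (hN : ∀ (i j : Fin n) (hij : i ≠ j), transvection hij 1 ∈ N) (k : Fin n)
    {A : SpecialLinearGroup (Fin n) ℤ} (hA : StandardColumns k A) :
    ∃ E ∈ N, StandardColumns (k + 1) (E * A) := by
  -- Euclid's algorithm in the `k`-th column
  obtain ⟨B, ⟨⟨E₀, hE₀, rfl⟩, hB⟩, hmin⟩ := WellFounded.has_min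
    (InvImage.wf (fun A : SpecialLinearGroup (Fin n) ℤ => ∑ i, if k ≤ i then (A i k).natAbs else 0)
      (wellFounded_lt (α := ℕ)))
    {B | (∃ E ∈ N, B = E * A) ∧ StandardColumns k B} ⟨A, ⟨1, N.one_mem, (one_mul A).symm⟩, hA⟩
  -- If this failed, adding or subtracting row `j` would shrink the entry in row `i`. Two nonzero
  -- entries would then each be strictly smaller than the other.
  have hone : ∀ i j, i ≠ j → k ≤ i → k ≤ j → (E₀ * A) j k ≠ 0 →
      ((E₀ * A) i k).natAbs < ((E₀ * A) j k).natAbs := by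
    intro i j hij hi hj hne
    by_contra hlt
    push Not at hlt
    have hred : ∃ t : ℤ, ((E₀ * A) i k + t * (E₀ * A) j k).natAbs < ((E₀ * A) i k).natAbs := by
      have h1 := Int.natAbs_pos.2 hne
      rcases le_total 0 ((E₀ * A) i k) with hx | hx <;> rcases le_total 0 ((E₀ * A) j k) with hy | hy
      · exact ⟨-1, by omega⟩
      · exact ⟨1, by omega⟩
      · exact ⟨1, by omega⟩
      · exact ⟨-1, by omega⟩
    obtain ⟨t, ht⟩ := hred
    refine hmin (transvection hij t * (E₀ * A)) ⟨⟨transvection hij t * E₀,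
      N.mul_mem (transvection_mem hN hij t) hE₀, by rw [mul_assoc]⟩, hB.transvection_mul hij hj t⟩ ?_
    refine Finset.sum_lt_sum (fun r _ => ?_) ⟨i, Finset.mem_univ i, ?_⟩
    · rw [transvection_mul_apply]
      split_ifs with h1 h2
      · rw [h2]
        exact ht.le
      · exact le_rfl
      · exact le_rfl
    · rw [transvection_mul_apply, if_pos hi, if_pos hi, if_pos rfl]
      exact ht
  -- reduce to the case where the `k`-th entry is `1`
  have hclear : ∀ C : SpecialLinearGroup (Fin n) ℤ, StandardColumns k C → C k k = 1 →
      ∃ E ∈ N, StandardColumns (k + 1) (E * C) := by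
    intro C hC hCk
    have : ∀ s : Finset (Fin n), ∃ E ∈ N, StandardColumns k (E * C) ∧ (E * C) k k = 1 ∧
        ∀ i ∈ s, i ≠ k → (E * C) i k = 0 := by
      intro s
      induction s using Finset.induction_on with
      | empty => exact ⟨1, N.one_mem, by rwa [one_mul], by rwa [one_mul], by simp⟩
      | insert i s _ ih =>
        obtain ⟨E, hE, h1, h2, h3⟩ := ih
        by_cases hik : i = k
        · refine ⟨E, hE, h1, h2, fun j hj hjk => ?_⟩
          exact h3 j (Finset.mem_of_mem_insert_of_ne hj (by rwa [hik])) hjk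
        · refine ⟨transvection hik (-(E * C) i k) * E, N.mul_mem (transvection_mem hN hik _) hE,
            ?_, ?_, fun j hj hjk => ?_⟩
          · rw [mul_assoc]
            exact h1.transvection_mul hik le_rfl _
          · rw [mul_assoc, transvection_mul_apply, if_neg (Ne.symm hik), h2]
          · rw [mul_assoc, transvection_mul_apply, h2]
            split_ifs with hji
            · ring
            · exact h3 j (Finset.mem_of_mem_insert_of_ne hj hji) hjk
    obtain ⟨E, hE, h1, h2, h3⟩ := this Finset.univ
    refine ⟨E, hE, fun i j hj => ?_⟩
    rcases Nat.lt_succ_iff_lt_or_eq.1 hj with hj | hj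
    · exact h1 i j hj
    · obtain rfl := Fin.ext hj
      by_cases hij : i = j
      · rw [hij, h2, Matrix.one_apply_eq]
      · rw [h3 i (Finset.mem_univ i) hij, Matrix.one_apply_ne hij]
  suffices h : ∃ E ∈ N, StandardColumns k (E * (E₀ * A)) ∧ (E * (E₀ * A)) k k = 1 by
    obtain ⟨E, hE, h1, h2⟩ := h
    obtain ⟨E', hE', h3⟩ := hclear _ h1 h2
    exact ⟨E' * E * E₀, N.mul_mem (N.mul_mem hE' hE) hE₀, by rwa [mul_assoc, mul_assoc]⟩
  set B := E₀ * A with hBdef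
  have hsum := hB.sum_eq_one
  obtain ⟨r, hr, hrk⟩ : ∃ r, k ≤ r ∧ B r k ≠ 0 := by
    by_contra hcon
    push Not at hcon
    rw [Finset.sum_eq_zero] at hsum
    · exact zero_ne_one hsum
    · intro i _
      split_ifs with hi
      · rw [hcon i hi, mul_zero]
      · rfl
  have hzero : ∀ i, i ≠ r → k ≤ i → B i k = 0 := by
    intro i hir hi
    by_contra hne
    exact lt_asymm (hone i r hir hi hr hrk) (hone r i hir.symm hr hi hne)
  have hunit : B⁻¹ k r * B r k = 1 := by
    refine Eq.trans ?_ hsum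
    rw [Finset.sum_eq_single r, if_pos hr]
    · intro i _ hir
      split_ifs with hi
      · rw [hzero i hir hi, mul_zero]
      · rfl
    · intro h
      exact absurd (Finset.mem_univ r) h
  have hsq : B r k = 1 ∨ B r k = -1 :=
    Int.isUnit_iff.1 (IsUnit.of_mul_eq_one_right _ hunit)
  by_cases hrk' : r = k
  · subst hrk'
    rcases hsq with h | h
    · exact ⟨1, N.one_mem, by rwa [one_mul], by rwa [one_mul]⟩
    by_cases hlast : ∃ l, r < l
    · obtain ⟨l, hl⟩ := hlast
      -- Adding row `r` to row `l` copies the `-1` there; subtracting twice row `l` from row `r`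
      -- then gives `-1 + 2 = 1`.
      refine ⟨transvection hl.ne (-2) * transvection hl.ne' 1,
        N.mul_mem (transvection_mem hN _ _) (transvection_mem hN _ _), ?_, ?_⟩
      · rw [mul_assoc]
        exact (hB.transvection_mul hl.ne' le_rfl 1).transvection_mul hl.ne hl.le _
      · rw [mul_assoc, transvection_mul_apply, if_pos rfl, transvection_mul_apply,
          transvection_mul_apply, if_neg hl.ne, if_pos rfl, hzero l hl.ne' hl.le, h]
        norm_num
    -- In the last column there is no spare row, but the matrix is upper triangular with determinant
    -- equal to this entry, which excludes `-1`.
    · push Not at hlast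
      exfalso
      have htri : (B : Matrix (Fin n) (Fin n) ℤ).BlockTriangular id := by
        intro i j hij
        replace hij : j < i := hij
        rw [hB i j (lt_of_lt_of_le hij (hlast i)), Matrix.one_apply_ne hij.ne']
      have hdet := Matrix.det_of_isUpperTriangular htri
      rw [B.det_coe, Finset.prod_eq_single r, h] at hdet
      · norm_num at hdet
      · intro i _ hir
        rw [hB i i (Fin.lt_def.1 (lt_of_le_of_ne (hlast i) hir)), Matrix.one_apply_eq]
      · intro h
        exact absurd (Finset.mem_univ r) h
  -- Entry `k` is zero, and adding `B r k` times row `r` makes it `(B r k) ^ 2 = 1`.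
  · refine ⟨transvection (Ne.symm hrk') (B r k), transvection_mem hN _ _,
      hB.transvection_mul _ hr _, ?_⟩
    rw [transvection_mul_apply, if_pos rfl, hzero k (Ne.symm hrk') le_rfl]
    rcases hsq with h | h <;> rw [h] <;> norm_num

theorem eq_top_of_transvection_mem {N : Subgroup (SpecialLinearGroup (Fin n) ℤ)}
    (hN : ∀ (i j : Fin n) (hij : i ≠ j), transvection hij 1 ∈ N) : N = ⊤ := by
  rw [Subgroup.eq_top_iff']
  intro A
  have : ∀ k ≤ n, ∃ E ∈ N, StandardColumns k (E * A) := by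
    intro k
    induction k with
    | zero => exact fun _ => ⟨1, N.one_mem, fun i j hj => absurd hj (Nat.not_lt_zero _)⟩
    | succ k ih =>
      intro hk
      obtain ⟨E, hE, h⟩ := ih (by omega)
      obtain ⟨E', hE', h'⟩ := exists_standardColumns_succ hN ⟨k, hk⟩ h
      exact ⟨E' * E, N.mul_mem hE' hE, by rwa [mul_assoc]⟩
  obtain ⟨E, hE, h⟩ := this n le_rfl
  have : E * A = 1 := Subtype.ext (Matrix.ext fun i j => h i j j.2)
  rw [eq_inv_of_mul_eq_one_right this]
  exact N.inv_mem hE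

end Matrix.SpecialLinearGroup

/-! ### Involutions generating the special linear group over the integers -/

namespace Matrix.SpecialLinearGroup

variable {ι : Type*} [Fintype ι] [DecidableEq ι]

/-- The standard basis vectors. -/
def basisVec (i : ι) : ι → ℤ := Pi.single i 1

theorem toLin'_transvection_basisVec {i j : ι} (hij : i ≠ j) (t : ℤ) (k : ι) :
    toLin' (transvection hij t) (basisVec k) =
      if k = j then basisVec j + t • basisVec i else basisVec k := by
  rw [toLin'_apply, Matrix.toLin'_apply]
  ext r
  simp only [basisVec, Matrix.mulVec_single_one, Matrix.col_apply, transvection_coe]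
  split_ifs with h
  · subst h
    by_cases h1 : r = i
    · subst h1
      simp [hij]
    · simp [Matrix.one_apply, Pi.single_apply, h1, Ne.symm h1]
  · simp [Matrix.one_apply, Pi.single_apply, Ne.symm h]

theorem ext_basisVec {A B : SpecialLinearGroup ι ℤ}
    (h : ∀ i, toLin' A (basisVec i) = toLin' B (basisVec i)) : A = B := by
  refine Subtype.ext (Matrix.ext fun r i => ?_)
  have := congrFun (h i) r
  rw [toLin'_apply, toLin'_apply, Matrix.toLin'_apply, Matrix.toLin'_apply] at this
  simpa [basisVec] using this

/-- `i ↦ -j`, `j ↦ i`. -/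
def quarterTurn {i j : ι} (hij : i ≠ j) : SpecialLinearGroup ι ℤ :=
  transvection hij 1 * transvection hij.symm (-1) * transvection hij 1

theorem quarterTurn_basisVec {i j : ι} (hij : i ≠ j) (k : ι) :
    toLin' (quarterTurn hij) (basisVec k) =
      if k = i then -basisVec j else if k = j then basisVec i else basisVec k := by
  have := hij.symm
  by_cases h1 : k = i <;> by_cases h2 : k = j <;>
    simp_all [quarterTurn, toLin'_transvection_basisVec]

/-- `i ↦ -i`, `j ↦ -j`. -/
def halfTurn {i j : ι} (hij : i ≠ j) : SpecialLinearGroup ι ℤ := quarterTurn hij * quarterTurn hij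

theorem halfTurn_basisVec {i j : ι} (hij : i ≠ j) (k : ι) :
    toLin' (halfTurn hij) (basisVec k) =
      if k = i then -basisVec i else if k = j then -basisVec j else basisVec k := by
  have := hij.symm
  by_cases h1 : k = i <;> by_cases h2 : k = j <;>
    simp_all [halfTurn, quarterTurn_basisVec]

variable {a b c : ι} (hab : a ≠ b) (hac : a ≠ c) (hbc : b ≠ c)

/-- `a ↦ -a - b`, `b ↦ b`, `c ↦ -c`. -/
def fold : SpecialLinearGroup ι ℤ := transvection hab.symm 1 * halfTurn hac

theorem fold_basisVec (k : ι) : toLin' (fold hab hac) (basisVec k) =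
    if k = a then -basisVec a - basisVec b else if k = c then -basisVec c else basisVec k := by
  have := hab.symm
  have := hac.symm
  by_cases h1 : k = a <;> by_cases h3 : k = c <;>
    simp_all [fold, halfTurn_basisVec, toLin'_transvection_basisVec]
  abel

/-- `a ↦ b`, `b ↦ a`, `c ↦ -c`. -/
def flip : SpecialLinearGroup ι ℤ := halfTurn hbc * quarterTurn hab

theorem flip_basisVec (hac : a ≠ c) (k : ι) : toLin' (flip hab hbc) (basisVec k) =
    if k = a then basisVec b else if k = b then basisVec a else if k = c then -basisVec c
    else basisVec k := by
  have := hab.symm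
  have := hac.symm
  have := hbc.symm
  by_cases h1 : k = a <;> by_cases h2 : k = b <;> by_cases h3 : k = c <;>
    simp_all [flip, halfTurn_basisVec, quarterTurn_basisVec]

/-- `a ↦ -a`, `b ↦ c`, `c ↦ b`. -/
def turn : SpecialLinearGroup ι ℤ := halfTurn hac * quarterTurn hbc

theorem turn_basisVec (hab : a ≠ b) (k : ι) : toLin' (turn hac hbc) (basisVec k) =
    if k = a then -basisVec a else if k = b then basisVec c else if k = c then basisVec b
    else basisVec k := by
  have := hab.symm
  have := hac.symm
  have := hbc.symm
  by_cases h1 : k = a <;> by_cases h2 : k = b <;> by_cases h3 : k = c <;>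
    simp_all [turn, halfTurn_basisVec, quarterTurn_basisVec]

/-- `a ↦ -b`, `b ↦ -a`, `c ↦ k`, `k ↦ c`. -/
def doubleSwap {k : ι} (hak : a ≠ k) (hck : c ≠ k) : SpecialLinearGroup ι ℤ :=
  halfTurn hak * quarterTurn hab * quarterTurn hck

theorem doubleSwap_basisVec (hac : a ≠ c) (hbc : b ≠ c) {k : ι} (hak : a ≠ k)
    (hbk : b ≠ k) (hck : c ≠ k) (i : ι) :
    toLin' (doubleSwap hab hak hck) (basisVec i) =
      if i = a then -basisVec b else if i = b then -basisVec a else if i = c then basisVec k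
      else if i = k then basisVec c else basisVec i := by
  have := hab.symm
  have := hac.symm
  have := hbc.symm
  have := hak.symm
  have := hbk.symm
  have := hck.symm
  by_cases h1 : i = a <;> by_cases h2 : i = b <;> by_cases h3 : i = c <;> by_cases h4 : i = k <;>
    simp_all [doubleSwap, halfTurn_basisVec, quarterTurn_basisVec]

end Matrix.SpecialLinearGroup

namespace Matrix.SpecialLinearGroup

variable {ι : Type*} [Fintype ι] [DecidableEq ι]

variable {a b c : ι}

theorem fold_sq (hab : a ≠ b) (hac : a ≠ c) (hbc : b ≠ c) :
    (fold hab hac) ^ 2 = 1 := by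
  have := hab.symm
  have := hac.symm
  have := hbc.symm
  refine ext_basisVec fun i => ?_
  by_cases h1 : i = a <;> by_cases h2 : i = b <;> by_cases h3 : i = c <;>
    simp_all [pow_succ, LinearEquiv.mul_apply, fold_basisVec]

theorem flip_sq (hab : a ≠ b) (hac : a ≠ c) (hbc : b ≠ c) :
    (flip hab hbc) ^ 2 = 1 := by
  have := hab.symm
  have := hac.symm
  have := hbc.symm
  refine ext_basisVec fun i => ?_
  by_cases h1 : i = a <;> by_cases h2 : i = b <;> by_cases h3 : i = c <;>
    simp_all [pow_succ, LinearEquiv.mul_apply, flip_basisVec]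

theorem turn_sq (hab : a ≠ b) (hac : a ≠ c) (hbc : b ≠ c) :
    (turn hac hbc) ^ 2 = 1 := by
  have := hab.symm
  have := hac.symm
  have := hbc.symm
  refine ext_basisVec fun i => ?_
  by_cases h1 : i = a <;> by_cases h2 : i = b <;> by_cases h3 : i = c <;>
    simp_all [pow_succ, LinearEquiv.mul_apply, turn_basisVec]

theorem halfTurn_sq (hab : a ≠ b) : halfTurn hab ^ 2 = 1 := by
  have := hab.symm
  refine ext_basisVec fun i => ?_
  by_cases h1 : i = a <;> by_cases h2 : i = b <;>
    simp_all [pow_succ, LinearEquiv.mul_apply, halfTurn_basisVec]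

theorem doubleSwap_sq (hab : a ≠ b) (hac : a ≠ c) (hbc : b ≠ c) {k : ι} (hak : a ≠ k)
    (hbk : b ≠ k) (hck : c ≠ k) :
    (doubleSwap hab hak hck) ^ 2 = 1 := by
  have := hab.symm
  have := hac.symm
  have := hbc.symm
  have := hak.symm
  have := hbk.symm
  have := hck.symm
  refine ext_basisVec fun i => ?_
  by_cases h1 : i = a <;> by_cases h2 : i = b <;> by_cases h3 : i = c <;> by_cases h4 : i = k <;>
    simp_all [pow_succ, LinearEquiv.mul_apply, doubleSwap_basisVec]

theorem fold_mul_flip (hab : a ≠ b) (hac : a ≠ c) (hbc : b ≠ c) :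
    (fold hab hac * flip hab hbc) ^ 3 = 1 := by
  have := hab.symm
  have := hac.symm
  have := hbc.symm
  refine ext_basisVec fun i => ?_
  by_cases h1 : i = a <;> by_cases h2 : i = b <;> by_cases h3 : i = c <;>
    simp_all [pow_succ, LinearEquiv.mul_apply, flip_basisVec, fold_basisVec] <;> abel

theorem fold_mul_turn (hab : a ≠ b) (hac : a ≠ c) (hbc : b ≠ c) :
    (fold hab hac * turn hac hbc) ^ 4 = 1 := by
  have := hab.symm
  have := hac.symm
  have := hbc.symm
  refine ext_basisVec fun i => ?_
  by_cases h1 : i = a <;> by_cases h2 : i = b <;> by_cases h3 : i = c <;>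
    simp_all [pow_succ, LinearEquiv.mul_apply, fold_basisVec, turn_basisVec]
  abel

theorem fold_mul_halfTurn (hab : a ≠ b) (hac : a ≠ c) (hbc : b ≠ c) :
    (fold hab hac * halfTurn hab) ^ 2 = 1 := by
  have := hab.symm
  have := hac.symm
  have := hbc.symm
  refine ext_basisVec fun i => ?_
  by_cases h1 : i = a <;> by_cases h2 : i = b <;> by_cases h3 : i = c <;>
    simp_all [pow_succ, LinearEquiv.mul_apply, fold_basisVec, halfTurn_basisVec]

theorem flip_mul_turn (hab : a ≠ b) (hac : a ≠ c) (hbc : b ≠ c) :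
    (flip hab hbc * turn hac hbc) ^ 6 = 1 := by
  have := hab.symm
  have := hac.symm
  have := hbc.symm
  refine ext_basisVec fun i => ?_
  by_cases h1 : i = a <;> by_cases h2 : i = b <;> by_cases h3 : i = c <;>
    simp_all [pow_succ, LinearEquiv.mul_apply, flip_basisVec, turn_basisVec]

theorem flip_mul_halfTurn (hab : a ≠ b) (hac : a ≠ c) (hbc : b ≠ c) :
    (flip hab hbc * halfTurn hab) ^ 2 = 1 := by
  have := hab.symm
  have := hac.symm
  have := hbc.symm
  refine ext_basisVec fun i => ?_
  by_cases h1 : i = a <;> by_cases h2 : i = b <;> by_cases h3 : i = c <;>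
    simp_all [pow_succ, LinearEquiv.mul_apply, flip_basisVec, halfTurn_basisVec]

theorem turn_mul_halfTurn (hab : a ≠ b) (hac : a ≠ c) (hbc : b ≠ c) :
    (turn hac hbc * halfTurn hab) ^ 4 = 1 := by
  have := hab.symm
  have := hac.symm
  have := hbc.symm
  refine ext_basisVec fun i => ?_
  by_cases h1 : i = a <;> by_cases h2 : i = b <;> by_cases h3 : i = c <;>
    simp_all [pow_succ, LinearEquiv.mul_apply, halfTurn_basisVec, turn_basisVec]

theorem fold_mul_doubleSwap (hab : a ≠ b) (hac : a ≠ c) (hbc : b ≠ c) {k : ι} (hak : a ≠ k)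
    (hbk : b ≠ k) (hck : c ≠ k) :
    (fold hab hac * doubleSwap hab hak hck) ^ 12 = 1 := by
  have := hab.symm
  have := hac.symm
  have := hbc.symm
  have := hak.symm
  have := hbk.symm
  have := hck.symm
  refine ext_basisVec fun i => ?_
  by_cases h1 : i = a <;> by_cases h2 : i = b <;> by_cases h3 : i = c <;> by_cases h4 : i = k <;>
    simp_all [pow_succ, LinearEquiv.mul_apply, doubleSwap_basisVec, fold_basisVec]

theorem flip_mul_doubleSwap (hab : a ≠ b) (hac : a ≠ c) (hbc : b ≠ c) {k : ι} (hak : a ≠ k)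
    (hbk : b ≠ k) (hck : c ≠ k) :
    (flip hab hbc * doubleSwap hab hak hck) ^ 4 = 1 := by
  have := hab.symm
  have := hac.symm
  have := hbc.symm
  have := hak.symm
  have := hbk.symm
  have := hck.symm
  refine ext_basisVec fun i => ?_
  by_cases h1 : i = a <;> by_cases h2 : i = b <;> by_cases h3 : i = c <;> by_cases h4 : i = k <;>
    simp_all [pow_succ, LinearEquiv.mul_apply, doubleSwap_basisVec, flip_basisVec]

theorem turn_mul_doubleSwap (hab : a ≠ b) (hac : a ≠ c) (hbc : b ≠ c) {k : ι} (hak : a ≠ k)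
    (hbk : b ≠ k) (hck : c ≠ k) :
    (turn hac hbc * doubleSwap hab hak hck) ^ 8 = 1 := by
  have := hab.symm
  have := hac.symm
  have := hbc.symm
  have := hak.symm
  have := hbk.symm
  have := hck.symm
  refine ext_basisVec fun i => ?_
  by_cases h1 : i = a <;> by_cases h2 : i = b <;> by_cases h3 : i = c <;> by_cases h4 : i = k <;>
    simp_all [pow_succ, LinearEquiv.mul_apply, doubleSwap_basisVec, turn_basisVec]

theorem halfTurn_mul_doubleSwap (hab : a ≠ b) (hac : a ≠ c) (hbc : b ≠ c) {k : ι} (hak : a ≠ k)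
    (hbk : b ≠ k) (hck : c ≠ k) :
    (halfTurn hab * doubleSwap hab hak hck) ^ 2 = 1 := by
  have := hab.symm
  have := hac.symm
  have := hbc.symm
  have := hak.symm
  have := hbk.symm
  have := hck.symm
  refine ext_basisVec fun i => ?_
  by_cases h1 : i = a <;> by_cases h2 : i = b <;> by_cases h3 : i = c <;> by_cases h4 : i = k <;>
    simp_all [pow_succ, LinearEquiv.mul_apply, doubleSwap_basisVec, halfTurn_basisVec]

theorem doubleSwap_mul_doubleSwap (hab : a ≠ b) (hac : a ≠ c) (hbc : b ≠ c) {k l : ι} (hak : a ≠ k)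
    (hbk : b ≠ k) (hck : c ≠ k) (hal : a ≠ l) (hbl : b ≠ l) (hcl : c ≠ l) (hkl : k ≠ l) :
    (doubleSwap hab hak hck * doubleSwap hab hal hcl) ^ 3 = 1 := by
  have := hab.symm
  have := hac.symm
  have := hbc.symm
  have := hak.symm
  have := hbk.symm
  have := hck.symm
  have := hal.symm
  have := hbl.symm
  have := hcl.symm
  have := hkl.symm
  refine ext_basisVec fun i => ?_
  by_cases h1 : i = a <;> by_cases h2 : i = b <;> by_cases h3 : i = c <;> by_cases h4 : i = k <;>
    by_cases h5 : i = l <;> simp_all [pow_succ, LinearEquiv.mul_apply, doubleSwap_basisVec]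

/-- A set of involutions generating the special linear group over the integers. -/
def involutions (hab : a ≠ b) (hac : a ≠ c) (hbc : b ≠ c) : Set (SpecialLinearGroup ι ℤ) :=
  {fold hab hac, flip hab hbc, turn hac hbc, halfTurn hab} ∪
    {g | ∃ (k : ι) (hak : a ≠ k) (_ : b ≠ k) (hck : c ≠ k), doubleSwap hab hak hck = g}

variable (hab : a ≠ b) (hac : a ≠ c) (hbc : b ≠ c)

theorem involutions_finite : (involutions hab hac hbc).Finite := by
  refine Set.Finite.union (by simp) ?_
  refine (Set.finite_range fun k : ι =>
    if h : a ≠ k ∧ c ≠ k then doubleSwap hab h.1 h.2 else 1).subset ?_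
  rintro _ ⟨k, hak, _, hck, rfl⟩
  exact ⟨k, dif_pos ⟨hak, hck⟩⟩

theorem sq_of_mem_involutions {s : SpecialLinearGroup ι ℤ} (hs : s ∈ involutions hab hac hbc) :
    s ^ 2 = 1 := by
  rcases hs with (rfl | rfl | rfl | rfl) | ⟨k, hak, hbk, hck, rfl⟩
  · exact fold_sq hab hac hbc
  · exact flip_sq hab hac hbc
  · exact turn_sq hab hac hbc
  · exact halfTurn_sq hab
  · exact doubleSwap_sq hab hac hbc hak hbk hck

/-- Products with `doubleSwap` bring in the exponents 8 and 12, whose least common multiple is 24.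
-/
theorem pow_of_mem_involutions {s t : SpecialLinearGroup ι ℤ} (hs : s ∈ involutions hab hac hbc)
    (ht : t ∈ involutions hab hac hbc) : (s * t) ^ 24 = 1 := by
  have hs2 := sq_of_mem_involutions hab hac hbc hs
  have ht2 := sq_of_mem_involutions hab hac hbc ht
  have hself : ∀ s : SpecialLinearGroup ι ℤ, s ^ 2 = 1 → (s * s) ^ 24 = 1 := fun s hs => by
    rw [← pow_two, hs, one_pow]
  rcases hs with (rfl | rfl | rfl | rfl) | ⟨k, ak, bk, ck, rfl⟩ <;>
    rcases ht with (rfl | rfl | rfl | rfl) | ⟨l, al, bl, cl, rfl⟩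
  · exact hself _ hs2
  · exact pow_eq_one_of_dvd (by norm_num)
        (fold_mul_flip hab hac hbc)
  · exact pow_eq_one_of_dvd (by norm_num)
        (fold_mul_turn hab hac hbc)
  · exact pow_eq_one_of_dvd (by norm_num)
        (fold_mul_halfTurn hab hac hbc)
  · exact pow_eq_one_of_dvd (by norm_num)
        (fold_mul_doubleSwap hab hac hbc al bl cl)
  · exact pow_mul_swap ht2 hs2 (pow_eq_one_of_dvd (by norm_num)
        (fold_mul_flip hab hac hbc))
  · exact hself _ hs2
  · exact pow_eq_one_of_dvd (by norm_num)
        (flip_mul_turn hab hac hbc)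
  · exact pow_eq_one_of_dvd (by norm_num)
        (flip_mul_halfTurn hab hac hbc)
  · exact pow_eq_one_of_dvd (by norm_num)
        (flip_mul_doubleSwap hab hac hbc al bl cl)
  · exact pow_mul_swap ht2 hs2 (pow_eq_one_of_dvd (by norm_num)
        (fold_mul_turn hab hac hbc))
  · exact pow_mul_swap ht2 hs2 (pow_eq_one_of_dvd (by norm_num)
        (flip_mul_turn hab hac hbc))
  · exact hself _ hs2
  · exact pow_eq_one_of_dvd (by norm_num)
        (turn_mul_halfTurn hab hac hbc)
  · exact pow_eq_one_of_dvd (by norm_num)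
        (turn_mul_doubleSwap hab hac hbc al bl cl)
  · exact pow_mul_swap ht2 hs2 (pow_eq_one_of_dvd (by norm_num)
        (fold_mul_halfTurn hab hac hbc))
  · exact pow_mul_swap ht2 hs2 (pow_eq_one_of_dvd (by norm_num)
        (flip_mul_halfTurn hab hac hbc))
  · exact pow_mul_swap ht2 hs2 (pow_eq_one_of_dvd (by norm_num)
        (turn_mul_halfTurn hab hac hbc))
  · exact hself _ hs2
  · exact pow_eq_one_of_dvd (by norm_num)
        (halfTurn_mul_doubleSwap hab hac hbc al bl cl)
  · exact pow_mul_swap ht2 hs2 (pow_eq_one_of_dvd (by norm_num)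
        (fold_mul_doubleSwap hab hac hbc ak bk ck))
  · exact pow_mul_swap ht2 hs2 (pow_eq_one_of_dvd (by norm_num)
        (flip_mul_doubleSwap hab hac hbc ak bk ck))
  · exact pow_mul_swap ht2 hs2 (pow_eq_one_of_dvd (by norm_num)
        (turn_mul_doubleSwap hab hac hbc ak bk ck))
  · exact pow_mul_swap ht2 hs2 (pow_eq_one_of_dvd (by norm_num)
        (halfTurn_mul_doubleSwap hab hac hbc ak bk ck))
  · by_cases hkl : k = l
    · subst hkl
      exact hself _ hs2
    · exact pow_eq_one_of_dvd (by norm_num)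
        (doubleSwap_mul_doubleSwap hab hac hbc ak bk ck al bl cl hkl)

/-- The commutator of the transvections `(i, j)` and `(j, k)` is the transvection `(i, k)`; the
relation is rearranged so that no inverses occur. -/
theorem transvection_mem_trans {N : Subgroup (SpecialLinearGroup ι ℤ)} {i j k : ι} (hij : i ≠ j)
    (hjk : j ≠ k) (hik : i ≠ k) (h1 : transvection hij 1 ∈ N) (h2 : transvection hjk 1 ∈ N) :
    transvection hik 1 ∈ N := by
  have : transvection hik 1 * (transvection hjk 1 * transvection hij 1) =
      transvection hij (1 : ℤ) * transvection hjk 1 := by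
    have := hij.symm
    have := hjk.symm
    have := hik.symm
    refine ext_basisVec fun r => ?_
    by_cases h1 : r = i <;> by_cases h2 : r = j <;> by_cases h3 : r = k <;>
      simp_all [toLin'_transvection_basisVec, LinearEquiv.mul_apply]
    abel
  rw [← N.mul_mem_cancel_right (N.mul_mem h2 h1), this]
  exact N.mul_mem h1 h2

/-- The relation says that `g` conjugates the first transvection to the inverse of the second. The
inverse appears because `turn` and `doubleSwap` change the sign of one of the two basis vectors
involved. -/
theorem transvection_mem_of_conj {N : Subgroup (SpecialLinearGroup ι ℤ)} {i j i' j' : ι}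
    (hij : i ≠ j) (hij' : i' ≠ j') {g : SpecialLinearGroup ι ℤ} (hg : g ∈ N)
    (h : transvection hij 1 ∈ N)
    (heq : transvection hij' 1 * (g * transvection hij 1) = g) : transvection hij' 1 ∈ N := by
  rw [← N.mul_mem_cancel_right (N.mul_mem hg h), heq]
  exact hg

/-- Cancelling a half turn from `fold` leaves the transvection `(b, a)`; conjugation by `flip`,
`turn` and `doubleSwap`, together with commutators, gives those joining `b` to any index.
Commutators through `b` give the rest. -/
theorem transvection_mem_closure {i j : ι} (hij : i ≠ j) :
    transvection hij 1 ∈ Subgroup.closure (involutions hab hac hbc) := by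
  set N := Subgroup.closure (involutions hab hac hbc) with hN
  have hba := hab.symm
  have hca := hac.symm
  have hcb := hbc.symm
  have hfold : fold hab hac ∈ N := Subgroup.subset_closure (by simp [involutions])
  have hflip : flip hab hbc ∈ N := Subgroup.subset_closure (by simp [involutions])
  have hturn : turn hac hbc ∈ N := Subgroup.subset_closure (by simp [involutions])
  have hhalf : halfTurn hab ∈ N := Subgroup.subset_closure (by simp [involutions])
  have hhalf' : halfTurn hac ∈ N := by
    have : halfTurn hac = turn hac hbc * halfTurn hab * turn hac hbc := by
      refine ext_basisVec fun i => ?_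
      by_cases h1 : i = a <;> by_cases h2 : i = b <;> by_cases h3 : i = c <;>
        simp_all [LinearEquiv.mul_apply, turn_basisVec, halfTurn_basisVec]
    rw [this]
    exact N.mul_mem (N.mul_mem hturn hhalf) hturn
  have eba : transvection hba 1 ∈ N := (N.mul_mem_cancel_right hhalf').1 hfold
  have eab : transvection hab 1 ∈ N := by
    have : transvection hab 1 = flip hab hbc * transvection hba 1 * flip hab hbc := by
      refine ext_basisVec fun i => ?_
      by_cases h1 : i = a <;> by_cases h2 : i = b <;> by_cases h3 : i = c <;>
        simp_all [LinearEquiv.mul_apply, flip_basisVec, toLin'_transvection_basisVec]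
    rw [this]
    exact N.mul_mem (N.mul_mem hflip eba) hflip
  have eca : transvection hca 1 ∈ N := by
    refine transvection_mem_of_conj hba hca hturn eba (ext_basisVec fun i => ?_)
    by_cases h1 : i = a <;> by_cases h2 : i = b <;> by_cases h3 : i = c <;>
      simp_all [LinearEquiv.mul_apply, turn_basisVec, toLin'_transvection_basisVec]
  have eac : transvection hac 1 ∈ N := by
    refine transvection_mem_of_conj hab hac hturn eab (ext_basisVec fun i => ?_)
    by_cases h1 : i = a <;> by_cases h2 : i = b <;> by_cases h3 : i = c <;>
      simp_all [LinearEquiv.mul_apply, turn_basisVec, toLin'_transvection_basisVec]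
  have key : ∀ k (hbk : b ≠ k), transvection hbk 1 ∈ N ∧ transvection hbk.symm 1 ∈ N := by
    intro k hbk
    by_cases hka : k = a
    · subst hka
      exact ⟨eba, eab⟩
    by_cases hkc : k = c
    · subst hkc
      exact ⟨transvection_mem_trans hba hac hbc eba eac, transvection_mem_trans hca hab hcb eca eab⟩
    have hak := Ne.symm hka
    have hck := Ne.symm hkc
    have hkb := hbk.symm
    have hswap : doubleSwap hab hak hck ∈ N :=
      Subgroup.subset_closure (Or.inr ⟨k, hak, hbk, hck, rfl⟩)
    constructor
    · refine transvection_mem_of_conj hac hbk hswap eac (ext_basisVec fun i => ?_)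
      by_cases h1 : i = a <;> by_cases h2 : i = b <;> by_cases h3 : i = c <;>
        by_cases h4 : i = k <;>
        simp_all [LinearEquiv.mul_apply, doubleSwap_basisVec, toLin'_transvection_basisVec]
    · refine transvection_mem_of_conj hca hkb hswap eca (ext_basisVec fun i => ?_)
      by_cases h1 : i = a <;> by_cases h2 : i = b <;> by_cases h3 : i = c <;>
        by_cases h4 : i = k <;>
        simp_all [LinearEquiv.mul_apply, doubleSwap_basisVec, toLin'_transvection_basisVec]
  by_cases hi : i = b
  · subst hi
    exact (key j hij).1
  by_cases hj : j = b
  · subst hj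
    exact (key i hij.symm).2
  exact transvection_mem_trans hi (Ne.symm hj) hij (key i (Ne.symm hi)).2 (key j (Ne.symm hj)).1

end Matrix.SpecialLinearGroup

/-! ### The fixed point theorem -/

theorem theorem1p5 {X : Type*} [TopologicalSpace X] [Nonempty X]
    (hX : UniquelyArcwiseConnected X) (n : ℕ) (hn : 3 ≤ n) :
    (∀ ρ : MulAut (FreeGroup (Fin n)) →* (X ≃ₜ X), ∃ x : X, ∀ g, ρ g x = x) ∧
    (∀ ρ : Matrix.SpecialLinearGroup (Fin n) ℤ →* (X ≃ₜ X), ∃ x : X, ∀ g, ρ g x = x) := by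
  have hab : (⟨0, by omega⟩ : Fin n) ≠ ⟨1, by omega⟩ := by simp
  have hac : (⟨0, by omega⟩ : Fin n) ≠ ⟨2, by omega⟩ := by simp
  have hbc : (⟨1, by omega⟩ : Fin n) ≠ ⟨2, by omega⟩ := by simp
  refine ⟨hX.exists_global_fixed (FreeGroup.involutions_finite hab hac hbc)
    (FreeGroup.closure_involutions hab hac hbc)
    (fun s hs => FreeGroup.sq_of_mem_involutions hab hac hbc hs)
    (fun s hs t ht => FreeGroup.pow_of_mem_involutions hab hac hbc hs ht), ?_⟩
  exact hX.exists_global_fixed (Matrix.SpecialLinearGroup.involutions_finite hab hac hbc)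
    (Matrix.SpecialLinearGroup.eq_top_of_transvection_mem fun i j hij =>
      Matrix.SpecialLinearGroup.transvection_mem_closure hab hac hbc hij)
    (fun s hs => Matrix.SpecialLinearGroup.sq_of_mem_involutions hab hac hbc hs)
    (fun s hs t ht => Matrix.SpecialLinearGroup.pow_of_mem_involutions hab hac hbc hs ht)
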